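/- Let $d\in\{2,3\}$ and let $\Omega\subset\mathbb R^d$ be a bounded, connected, nonempty open set with $\Omega=\operatorname{int}\overline\Omega$ (for instance a connected polygonal or polyhedral domain with Lipschitz boundary) that has a conforming triangulation $\mathcal T_h$: a finite set of closed non-degenerate $d$-simplices whose union is $\overline\Omega$, any two distinct ones meeting exactly in the simplex (possibly empty) spanned by their common vertices. For $\kappa\in\mathcal T_h$ let $\mathbb P_1(\kappa)$ be the polynomials of total degree at most $1$ restricted to $\kappa$, let $b_\kappa$ be the product of the $d+1$ barycentric coordinates of $\kappa$, and put $\mathcal P(\kappa)=\mathbb P_1(\kappa)\oplus\operatorname{Vect}\{b_\kappa\}$. Define the mini-element spaces $$X_{0h}=\{v\in\mathcal C^0(\overline\Omega)^d:\ v|_\kappa\in\mathcal P(\kappa)^d\ \ \forall\kappa\in\mathcal T_h\}\cap H^1_0(\Omega)^d,$$ $$M_h=\{q\in\mathcal C^0(\overline\Omega):\ q|_\kappa\in\mathbb P_1(\kappa)\ \ \forall\kappa\in\mathcal T_h\},\qquad M_{0h}=M_h\cap L^2_0(\Omega),$$ where $L^2_0(\Omega)$ is the space of functions in $L^2(\Omega)$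 with zero mean. Let $Re>0$, $\varepsilon_0>0$, let $\varepsilon_h\in M_h$ satisfy $\varepsilon_0\le\varepsilon_h\le1$ in $\Omega$, and let $\alpha,\beta$ be real functions that are positive on $[\varepsilon_0,1]$ and differentiable on $]\varepsilon_0,1[$ with positive and bounded derivatives there. Let $f\in L^2(\Omega)^d$ and $G\in H^1(\Omega)^d$. With $(\cdot,\cdot)$ the $L^2(\Omega)$ scalar product and $|\cdot|$ the Euclidean norm, put $$a_h(u,v)=\tfrac1{Re}(\varepsilon_h\nabla u,\nabla v)+(\alpha(\varepsilon_h)u,v),\qquad b_h(u,q)=(\operatorname{div}(\varepsilon_hu),q),\qquad \ell_h(v)=(\varepsilon_hf,v),$$ $$c_h(u,v,w)=(\varepsilon_h(u\cdot\nabla)v,w)+\tfrac12(\operatorname{div}(\varepsilon_hu)\,v,w)+(\beta(\varepsilon_h)|u|\,v,w).$$ Then for every given iterate $w_h^i\in X_{0h}$ there is exactly one pair $(w_h^{i+1},p_h^{i+1})\in X_{0h}\times M_{0h}$ such that $$a_h(w_h^{i+1},v_h)+c_h(w_h^i+G,w_h^{i+1},v_h)-b_h(v_h,p_h^{i+1})=\ell_h(v_h)-a_h(G,v_h)-c_h(w_h^i+G,G,v_h)\quad\forall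 v_h\in X_{0h},$$ $$b_h(w_h^{i+1},q_h)=0\quad\forall q_h\in M_{0h}.$$ -/

import Mathlib

noncomputable section

namespace DBF

open MeasureTheory Filter Topology
open scoped ContDiff

/-- Euclidean space `ℝ^d` with its Euclidean norm. -/
abbrev E (d : ℕ) : Type := EuclideanSpace ℝ (Fin d)

/-! ### Sobolev spaces through weak derivatives -/

/-- Test functions: smooth functions with compact support contained in `Ω`. -/
def IsTest {d : ℕ} (Ω : Set (E d)) (φ : E d → ℝ) : Prop :=
  ContDiff ℝ ∞ φ ∧ HasCompactSupport φ ∧ tsupport φ ⊆ Ω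

/-- Classical partial derivative `∂φ/∂x_i`. -/
def classicalPartial {d : ℕ} (i : Fin d) (φ : E d → ℝ) (x : E d) : ℝ :=
  fderiv ℝ φ x (EuclideanSpace.single i 1)

/-- `g` is the weak (distributional) partial derivative `∂u/∂x_i` of `u` in `Ω`;
both functions are locally integrable in `Ω`. -/
def HasWeakPartial {d : ℕ} (Ω : Set (E d)) (i : Fin d) (u g : E d → ℝ) : Prop :=
  LocallyIntegrableOn u Ω volume ∧ LocallyIntegrableOn g Ω volume ∧
    ∀ φ : E d → ℝ, IsTest Ω φ →
      ∫ x in Ω, u x * classicalPartial i φ x = - ∫ x in Ω, g x * φ x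

open Classical in
/-- The weak partial derivative `∂u/∂x_i` in `Ω` (unique almost everywhere in the open set `Ω`;
the value is `0` if there is none, which never occurs for the functions in `H¹(Ω)` below). -/
def weakPartial {d : ℕ} (Ω : Set (E d)) (i : Fin d) (u : E d → ℝ) : E d → ℝ :=
  if h : ∃ g, HasWeakPartial Ω i u g then h.choose else 0

/-- `u ∈ H¹(Ω)`: `u` and its weak first derivatives belong to `L²(Ω)`. -/
def MemH1 {d : ℕ} (Ω : Set (E d)) (u : E d → ℝ) : Prop :=
  MemLp u 2 (volume.restrict Ω) ∧
    ∀ i : Fin d, ∃ g, HasWeakPartial Ω i u g ∧ MemLp g 2 (volume.restrict Ω)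

/-- `u ∈ H¹₀(Ω)`: `u` is the limit in `H¹(Ω)` of a sequence of test functions. -/
def MemH10 {d : ℕ} (Ω : Set (E d)) (u : E d → ℝ) : Prop :=
  MemH1 Ω u ∧ ∃ φ : ℕ → E d → ℝ, (∀ n, IsTest Ω (φ n)) ∧
    Tendsto (fun n => eLpNorm (fun x => u x - φ n x) 2 (volume.restrict Ω)) atTop (𝓝 0) ∧
    ∀ i : Fin d, Tendsto
      (fun n => eLpNorm (fun x => weakPartial Ω i u x - classicalPartial i (φ n) x) 2
        (volume.restrict Ω)) atTop (𝓝 0)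

/-- `q ∈ L²₀(Ω)`: square integrable functions with zero mean. -/
def MemL20 {d : ℕ} (Ω : Set (E d)) (q : E d → ℝ) : Prop :=
  MemLp q 2 (volume.restrict Ω) ∧ ∫ x in Ω, q x = 0

/-- Vector-valued version of `H¹(Ω)`. -/
def MemH1Vec {d : ℕ} (Ω : Set (E d)) (u : E d → E d) : Prop :=
  ∀ j : Fin d, MemH1 Ω (fun x => u x j)

/-- Vector-valued version of `H¹₀(Ω)`. -/
def MemH10Vec {d : ℕ} (Ω : Set (E d)) (u : E d → E d) : Prop :=
  ∀ j : Fin d, MemH10 Ω (fun x => u x j)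

/-- Weak divergence. -/
def weakDiv {d : ℕ} (Ω : Set (E d)) (u : E d → E d) (x : E d) : ℝ :=
  ∑ i : Fin d, weakPartial Ω i (fun y => u y i) x

/-! ### Triangulations and the mini-element -/

/-- A non-degenerate `d`-simplex (triangle, tetrahedron), given by its `d + 1` affinely
independent vertices. -/
abbrev Elt (d : ℕ) : Type := AffineBasis (Fin (d + 1)) ℝ (E d)

/-- The set of vertices of a simplex. -/
def Elt.vertices {d : ℕ} (κ : Elt d) : Set (E d) := Set.range fun i : Fin (d + 1) => κ i

/-- The closed simplex. -/
def Elt.carrier {d : ℕ} (κ : Elt d) : Set (E d) := convexHull ℝ κ.vertices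

/-- The bubble function `b_κ`, the product of the barycentric coordinates of `κ`. -/
def Elt.bubble {d : ℕ} (κ : Elt d) (x : E d) : ℝ := ∏ i : Fin (d + 1), κ.coord i x

/-- A conforming triangulation of `Ω`: a finite set of non-degenerate closed simplices whose union
is the closure of `Ω`, two distinct ones meeting exactly in the simplex spanned by their common
vertices (nothing, a common vertex, an entire common edge or an entire common face). -/
structure Triangulation {d : ℕ} (Ω : Set (E d)) where
  elts : Finset (Elt d)
  injOn : Set.InjOn (fun κ : Elt d => κ.vertices) elts
  inter : ∀ κ ∈ elts, ∀ κ' ∈ elts, κ ≠ κ' →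
    κ.carrier ∩ κ'.carrier = convexHull ℝ (κ.vertices ∩ κ'.vertices)
  union : ⋃ κ ∈ elts, κ.carrier = closure Ω

/-- Extension by zero to `ℝ^d` of a function on the closure of `Ω`. -/
def ext {d : ℕ} {Ω : Set (E d)} {F : Type} [Zero F] (v : closure Ω → F) : E d → F :=
  Function.extend Subtype.val v 0

/-- `g` coincides on the set `K` with a polynomial of total degree at most one. -/
def IsP1On {d : ℕ} (K : Set (E d)) (g : E d → ℝ) : Prop :=
  ∃ p : MvPolynomial (Fin d) ℝ, p.totalDegree ≤ 1 ∧
    ∀ x ∈ K, g x = MvPolynomial.eval (fun i => x i) p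

/-- `g` belongs on `κ` to the local space `P₁(κ) ⊕ Vect {b_κ}` of the mini-element. -/
def IsMiniOn {d : ℕ} (κ : Elt d) (g : E d → ℝ) : Prop :=
  ∃ p : MvPolynomial (Fin d) ℝ, p.totalDegree ≤ 1 ∧ ∃ c : ℝ,
    ∀ x ∈ κ.carrier, g x = MvPolynomial.eval (fun i => x i) p + c * κ.bubble x

/-- The space `X_h` of continuous vector fields on the closure of `Ω`, each component of which
belongs on every element to the local space of the mini-element. -/
def Xh {d : ℕ} {Ω : Set (E d)} (T : Triangulation Ω) : Set C(closure Ω, E d) :=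
  {v | ∀ κ ∈ T.elts, ∀ j : Fin d, IsMiniOn κ (fun x => ext v x j)}

/-- `X_{0h} = X_h ∩ H¹₀(Ω)^d`. -/
def X0h {d : ℕ} {Ω : Set (E d)} (T : Triangulation Ω) : Set C(closure Ω, E d) :=
  {v | v ∈ Xh T ∧ MemH10Vec Ω (ext v)}

/-- The space `M_h` of continuous functions on the closure of `Ω` that are affine on every
element. -/
def Mh {d : ℕ} {Ω : Set (E d)} (T : Triangulation Ω) : Set C(closure Ω, ℝ) :=
  {q | ∀ κ ∈ T.elts, IsP1On κ.carrier (ext q)}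

/-- `M_{0h} = M_h ∩ L²₀(Ω)`. -/
def M0h {d : ℕ} {Ω : Set (E d)} (T : Triangulation Ω) : Set C(closure Ω, ℝ) :=
  {q | q ∈ Mh T ∧ MemL20 Ω (ext q)}

/-! ### The data and the forms -/

/-- The assumptions on the Darcy and the Forchheimer coefficient, as functions of the porosity:
positive on `[ε₀, 1]`, differentiable in `]ε₀, 1[` with positive and bounded derivative. -/
structure AdmissibleCoeff (ε₀ : ℝ) (α : ℝ → ℝ) : Prop where
  pos : ∀ t ∈ Set.Icc ε₀ 1, 0 < α t
  diff : ∀ t ∈ Set.Ioo ε₀ 1, DifferentiableAt ℝ α t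
  deriv_pos : ∀ t ∈ Set.Ioo ε₀ 1, 0 < deriv α t
  deriv_bdd : ∃ K : ℝ, ∀ t ∈ Set.Ioo ε₀ 1, deriv α t ≤ K

/-- `a_h(u,v) = Re⁻¹ (ε_h ∇u, ∇v) + (α(ε_h) u, v)`. -/
def aForm {d : ℕ} (Ω : Set (E d)) (Re : ℝ) (α : ℝ → ℝ) (ε : E d → ℝ) (u v : E d → E d) : ℝ :=
  1 / Re * (∫ x in Ω, ε x * ∑ i : Fin d, ∑ j : Fin d,
      weakPartial Ω i (fun y => u y j) x * weakPartial Ω i (fun y => v y j) x)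
    + ∫ x in Ω, α (ε x) * inner ℝ (u x) (v x)

/-- `c_h(u,v,w) = (ε_h (u·∇)v, w) + 1/2 (div(ε_h u) v, w) + (β(ε_h) |u| v, w)`. -/
def cForm {d : ℕ} (Ω : Set (E d)) (β : ℝ → ℝ) (ε : E d → ℝ) (u v w : E d → E d) : ℝ :=
  (∫ x in Ω, ε x * ∑ j : Fin d,
      (∑ i : Fin d, u x i * weakPartial Ω i (fun y => v y j) x) * w x j)
    + 1 / 2 * (∫ x in Ω, weakDiv Ω (fun y => ε y • u y) x * inner ℝ (v x) (w x))
    + ∫ x in Ω, β (ε x) * ‖u x‖ * inner ℝ (v x) (w x)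

/-- `b_h(u,q) = (div(ε_h u), q)`. -/
def bForm {d : ℕ} (Ω : Set (E d)) (ε : E d → ℝ) (u : E d → E d) (q : E d → ℝ) : ℝ :=
  ∫ x in Ω, weakDiv Ω (fun y => ε y • u y) x * q x

/-- `ℓ_h(v) = (ε_h f, v)`. -/
def lForm {d : ℕ} (Ω : Set (E d)) (ε : E d → ℝ) (f v : E d → E d) : ℝ :=
  ∫ x in Ω, inner ℝ (ε x • f x) (v x)

/-- `(w', p')` solves, for the given iterate `w`, the linearized discrete problem defining the
next iterate. -/
def IsNextIterate {d : ℕ} {Ω : Set (E d)} (T : Triangulation Ω) (Re : ℝ) (α β : ℝ → ℝ)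
    (εh : C(closure Ω, ℝ)) (f G : E d → E d) (w : C(closure Ω, E d))
    (w' : C(closure Ω, E d)) (p' : C(closure Ω, ℝ)) : Prop :=
  (∀ v ∈ X0h T,
    aForm Ω Re α (ext εh) (ext w') (ext v)
      + cForm Ω β (ext εh) (fun x => ext w x + G x) (ext w') (ext v)
      - bForm Ω (ext εh) (ext v) (ext p')
    = lForm Ω (ext εh) f (ext v)
      - aForm Ω Re α (ext εh) G (ext v)
      - cForm Ω β (ext εh) (fun x => ext w x + G x) G (ext v)) ∧
  ∀ q ∈ M0h T, bForm Ω (ext εh) (ext w') (ext q) = 0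

end DBF

end

noncomputable section

namespace DBF

open MeasureTheory Filter Topology
open scoped ContDiff

variable {d : ℕ} {Ω : Set (E d)}

/-! ### Lipschitz continuity -/

/-! The problem is a square linear system on the finite-dimensional space X₀ₕ × M₀ₕ, so existence
and uniqueness both follow once the homogeneous system has only the zero solution
(`existsUnique_saddle`). No inf-sup constant is needed, only two injectivity statements.

Velocity. Testing the homogeneous momentum equation with its own solution v removes the pressure, by
the discrete divergence constraint. The convection term and half the divergence term cancel for
every advecting field u in H¹ (`cForm_self`), because the integral of ∂ᵢUᵢ vⱼ² + 2 Uᵢ ∂ᵢvⱼ vⱼ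
vanishes for U = εu and vⱼ in H¹₀. What remains is a sum of nonnegative integrals, and the term
α(ε)|v|² alone forces v = 0 (`eq_zero_of_energy_nonpos`); Poincaré's inequality is not used.

Pressure. If b(·, p) vanishes on X₀ₕ, test with the bubble fields b_κ eⱼ. Integration by parts gives
minus the integral of ε ∂ⱼp b_κ, in which ∂ⱼp is constant on κ and ε b_κ has positive integral.
Hence p is constant on each element. Being continuous with finitely many values on the connected set
Ω, it is constant, and zero mean makes it zero (`eq_zero_of_bForm_eq_zero`).

The remaining work is analytic. Derivatives are weak derivatives known only almost everywhere, and
the two integrations by parts need a product rule for an H¹ function times a discrete one.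
Continuous piecewise mini-element functions are bounded, Lipschitz on balls inside Ω and
differentiable almost everywhere (`LipReg`). Mollification lets weak derivatives be tested against
compactly supported Lipschitz functions (`HasWeakPartial.integral_lipschitz`), which yields the
product rule `HasWeakPartial.mul_lipReg`. Since discrete fields are bounded, every trilinear
integrand is a product of two L² factors and bounded ones, so no Sobolev embedding enters. Finally
the bubbles must lie in H¹₀ as defined by approximation, which an explicit cut-off shows
(`Triangulation.memH10_bub`). -/

/-- A continuous function on `[0, 1]` whose increments are controlled, at every point, by
arbitrarily short steps to the right, has a controlled total increment. -/
theorem abs_sub_le_of_forall_exists_right {g : ℝ → ℝ} {C : ℝ} (hg : ContinuousOn g (Set.Icc 0 1))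
    (h : ∀ t ∈ Set.Ico (0 : ℝ) 1, ∀ y > t, ∃ s ∈ Set.Ioc t y, |g s - g t| ≤ C * (s - t)) :
    |g 1 - g 0| ≤ C := by
  -- Continuous induction: the set of good `t` is closed, contains 0, and from each of its points
  -- below 1 one can move further right.
  have key : Set.Icc (0 : ℝ) 1 ⊆ {t | |g t - g 0| ≤ C * t} := by
    apply IsClosed.Icc_subset_of_forall_exists_gt
    · have : {t | |g t - g 0| ≤ C * t} ∩ Set.Icc (0 : ℝ) 1
          = {t ∈ Set.Icc (0 : ℝ) 1 | |g t - g 0| ≤ C * t} := by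
        ext; simp [and_comm]
      rw [this]
      exact isClosed_Icc.isClosed_le ((hg.sub continuousOn_const).abs) (by fun_prop)
    · simp
    · rintro t ⟨ht, ht'⟩ y hy
      obtain ⟨s, hs, hst⟩ := h t ht' y hy
      refine ⟨s, ?_, hs⟩
      simp only [Set.mem_ofPred_eq] at ht ⊢
      have := abs_add_le (g s - g t) (g t - g 0)
      have e : g s - g t + (g t - g 0) = g s - g 0 := by ring
      rw [e] at this
      linarith
  simpa using key (Set.right_mem_Icc.2 zero_le_one)

/-- A continuous function on a convex set covered by finitely many closed sets on each of which it
is `K`-Lipschitz is `K`-Lipschitz. -/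
theorem lipschitzOnWith_of_finite_closed_cover {V ι : Type*} [NormedAddCommGroup V]
    [NormedSpace ℝ V] {s : Set V} (hs : Convex ℝ s) {f : V → ℝ} (hf : ContinuousOn f s)
    (I : Finset ι) (A : ι → Set V) (hA : ∀ k ∈ I, IsClosed (A k)) (hcov : s ⊆ ⋃ k ∈ I, A k)
    {K : NNReal} (hK : ∀ k ∈ I, LipschitzOnWith K f (s ∩ A k)) : LipschitzOnWith K f s := by
  apply LipschitzOnWith.of_dist_le_mul
  intro y hy x hx
  set L : ℝ → V := fun t => AffineMap.lineMap x y t with hL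
  have hLc : Continuous L := AffineMap.lineMap_continuous
  have hLs : Set.MapsTo L (Set.Icc 0 1) s := fun t ht => hs.lineMap_mem hx hy ht
  have hdist : ∀ a b : ℝ, dist (L a) (L b) = |a - b| * dist x y := by
    intro a b
    simp [hL, dist_lineMap_lineMap, Real.dist_eq]
  have main : |f (L 1) - f (L 0)| ≤ K * dist x y := by
    apply abs_sub_le_of_forall_exists_right (g := fun t => f (L t)) (hf.comp hLc.continuousOn hLs)
    intro t ht y' hy'
    have hmem : ∀ᶠ r in 𝓝[>] t, r ∈ Set.Ioc t (min y' 1) :=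
      Ioc_mem_nhdsGT (lt_min hy' ht.2)
    -- Pigeonhole: one of the finitely many closed pieces contains `L r` for `r` arbitrarily close
    -- to `t` on the right. By closedness it also contains `L t`, so the bound on that single piece
    -- controls the short increment.
    have hfreq : ∃ᶠ r in 𝓝[>] t, ∃ k ∈ I, L r ∈ A k := by
      refine (hmem.mono fun r hr => ?_).frequently
      have : L r ∈ s := hLs ⟨ht.1.trans hr.1.le, hr.2.trans (min_le_right _ _)⟩
      simpa using hcov this
    have : ∃ k ∈ I, ∃ᶠ r in 𝓝[>] t, L r ∈ A k := by
      by_contra hcon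
      push Not at hcon
      have : ∀ᶠ r in 𝓝[>] t, ∀ k ∈ I, L r ∉ A k :=
        (Finset.eventually_all I).2 hcon
      obtain ⟨r, ⟨k, hk, hr⟩, hr'⟩ := (hfreq.and_eventually this).exists
      exact hr' k hk hr
    obtain ⟨k, hk, hfr⟩ := this
    have htk : L t ∈ A k := by
      refine (hA k hk).mem_of_frequently_of_tendsto hfr ?_
      exact (hLc.tendsto t).mono_left nhdsWithin_le_nhds
    obtain ⟨r, hr, hr'⟩ := (hfr.and_eventually hmem).exists
    refine ⟨r, ⟨hr'.1, hr'.2.trans (min_le_left _ _)⟩, ?_⟩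
    have := (hK k hk).dist_le_mul (L r)
      ⟨hLs ⟨ht.1.trans hr'.1.le, hr'.2.trans (min_le_right _ _)⟩, hr⟩
      (L t) ⟨hLs ⟨ht.1, ht.2.le⟩, htk⟩
    rw [hdist, abs_of_pos (sub_pos.2 hr'.1), Real.dist_eq] at this
    linarith
  simpa [hL, Real.dist_eq, dist_comm] using main

/-- The product of a compactly supported Lipschitz function and a function that is uniformly
Lipschitz on the balls contained in `Ω` is Lipschitz. -/
theorem exists_lipschitzWith_mul {V : Type*} [NormedAddCommGroup V] [ProperSpace V] {Ω : Set V}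
    (hΩ : IsOpen Ω)
    {ρ φ : V → ℝ} {K L : NNReal}
    (hρ : ∀ x r, Metric.ball x r ⊆ Ω → LipschitzOnWith K ρ (Metric.ball x r))
    {M : ℝ} (hM : ∀ x ∈ Ω, |ρ x| ≤ M)
    (hφ : LipschitzWith L φ) (hφc : HasCompactSupport φ) (hφs : tsupport φ ⊆ Ω) :
    ∃ C : NNReal, LipschitzWith C (fun x => ρ x * φ x) := by
  rcases isEmpty_or_nonempty V with hV | ⟨⟨x0⟩⟩
  · exact ⟨0, fun x => (hV.false x).elim⟩
  obtain ⟨N, hN⟩ := hφ.continuous.bounded_above_of_compact_support hφc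
  have hN0 : 0 ≤ N := (norm_nonneg _).trans (hN x0)
  obtain ⟨δ, hδ, hδΩ⟩ := hφc.isCompact.exists_thickening_subset_open hΩ hφs
  set M' := max M 0
  have hM0 : 0 ≤ M' := le_max_right _ _
  have hB : ∀ x, |ρ x * φ x| ≤ M' * N := by
    intro x
    by_cases hx : φ x = 0
    · simp only [hx, mul_zero, abs_zero]; positivity
    · have : x ∈ Ω := hφs (subset_tsupport _ hx)
      rw [abs_mul]
      exact mul_le_mul ((hM x this).trans (le_max_left _ _)) (hN x) (abs_nonneg _) hM0
  -- The first two terms are the product-rule bound for points closer than `δ`, which share a ball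
  -- inside `Ω`. The last covers distant points, where the increment is at most twice the supremum.
  set C : ℝ := M' * L + K * N + 2 * (M' * N) / δ with hC
  have hC0 : 0 ≤ C := by positivity
  have main : ∀ x y, φ x ≠ 0 → |ρ x * φ x - ρ y * φ y| ≤ C * dist x y := by
    intro x y hx
    have hxs := subset_tsupport _ hx
    rcases lt_or_ge (dist x y) δ with hxy | hxy
    · have hb : Metric.ball x δ ⊆ Ω := (Metric.ball_subset_thickening hxs δ).trans hδΩ
      have h1 := (hρ x δ hb).dist_le_mul x (Metric.mem_ball_self hδ) y
        (by rwa [Metric.mem_ball, dist_comm])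
      have h2 := hφ.dist_le_mul x y
      rw [Real.dist_eq] at h1 h2
      have e : ρ x * φ x - ρ y * φ y = ρ x * (φ x - φ y) + (ρ x - ρ y) * φ y := by ring
      rw [e]
      refine (abs_add_le _ _).trans ?_
      rw [abs_mul, abs_mul]
      have h3 : |ρ x| * |φ x - φ y| ≤ M' * (L * dist x y) :=
        mul_le_mul ((hM x (hφs hxs)).trans (le_max_left _ _)) h2 (abs_nonneg _) hM0
      have h4 : |ρ x - ρ y| * |φ y| ≤ K * dist x y * N :=
        mul_le_mul h1 (hN y) (abs_nonneg _) (by positivity)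
      have h5 : 0 ≤ 2 * (M' * N) / δ * dist x y := by positivity
      rw [hC]
      linarith
    · have h1 := abs_sub (ρ x * φ x) (ρ y * φ y)
      have h2 : 2 * (M' * N) ≤ 2 * (M' * N) / δ * dist x y := by
        rw [div_mul_eq_mul_div, le_div_iff₀ hδ]
        gcongr
      have h5 : 0 ≤ (M' * L + K * N) * dist x y := by positivity
      have := hB x
      have := hB y
      rw [hC]
      linarith
  refine ⟨⟨C, hC0⟩, LipschitzWith.of_dist_le_mul fun x y => ?_⟩
  rw [Real.dist_eq]
  change _ ≤ C * _
  by_cases hx : φ x = 0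
  · by_cases hy : φ y = 0
    · simp only [hx, hy, mul_zero, sub_zero, abs_zero]; positivity
    · rw [abs_sub_comm, dist_comm]
      exact main y x hy
  · exact main x y hx

/-! ### Weak derivatives tested against Lipschitz functions -/

theorem norm_single_one {d : ℕ} (i : Fin d) : ‖(EuclideanSpace.single i 1 : E d)‖ = 1 := by
  simp

theorem measurable_classicalPartial {d : ℕ} (i : Fin d) (φ : E d → ℝ) :
    Measurable (classicalPartial i φ) :=
  measurable_fderiv_apply_const ℝ φ _

theorem abs_classicalPartial_le_of_lipschitzOn {d : ℕ} (i : Fin d) {ψ : E d → ℝ} {C : NNReal}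
    {s : Set (E d)} {x : E d} (hs : s ∈ 𝓝 x) (hψ : LipschitzOnWith C ψ s) :
    |classicalPartial i ψ x| ≤ C := by
  have h := (fderiv ℝ ψ x).le_opNorm (EuclideanSpace.single i 1)
  rw [norm_single_one, mul_one] at h
  exact h.trans (norm_fderiv_le_of_lipschitzOn ℝ hs hψ)

open scoped Convolution in
open ContinuousLinearMap in
/-- The partial derivatives of a regularization of a Lipschitz function. -/
theorem classicalPartial_convolution {d : ℕ} (i : Fin d) (η : ContDiffBump (0 : E d))
    {ψ : E d → ℝ} {C : NNReal} (hψ : LipschitzWith C ψ) (x : E d) :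
    classicalPartial i (η.normed volume ⋆[lsmul ℝ ℝ, volume] ψ) x
      = (η.normed volume ⋆[lsmul ℝ ℝ, volume] classicalPartial i ψ) x := by
  set e : E d := EuclideanSpace.single i 1
  have hη : Integrable (η.normed volume) (volume : Measure (E d)) := η.integrable_normed
  have hηc : Continuous (η.normed (volume : Measure (E d))) := η.continuous_normed
  have hd : DifferentiableAt ℝ (η.normed volume ⋆[lsmul ℝ ℝ, volume] ψ) x := by
    have := (η.hasCompactSupport_normed (μ := (volume : Measure (E d)))).contDiff_convolution_left
      (n := 1) (μ := (volume : Measure (E d))) (lsmul ℝ ℝ) η.contDiff_normed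
      hψ.continuous.locallyIntegrable
    exact (this.differentiable (by simp)) x
  have h1 : HasDerivAt (fun s : ℝ => ∫ t, η.normed volume t * ψ (x + s • e - t))
      (∫ t, η.normed volume t * classicalPartial i ψ (x - t)) 0 := by
    refine (hasDerivAt_integral_of_dominated_loc_of_lip (s := Set.univ)
      (bound := fun t => |η.normed volume t| * C) univ_mem ?_ ?_ ?_ ?_ ?_ ?_).2
    · refine Eventually.of_forall fun s => ?_
      exact (hηc.mul (hψ.continuous.comp (by fun_prop))).aestronglyMeasurable
    · refine (hηc.mul (hψ.continuous.comp (by fun_prop))).integrable_of_hasCompactSupport ?_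
      exact η.hasCompactSupport_normed.mul_right
    · exact (hηc.measurable.mul ((measurable_classicalPartial i ψ).comp
        (measurable_const.sub measurable_id))).aestronglyMeasurable
    · refine Eventually.of_forall fun t => LipschitzOnWith.of_dist_le_mul fun s _ s' _ => ?_
      have h := hψ.dist_le_mul (x + s • e - t) (x + s' • e - t)
      rw [Real.dist_eq] at h ⊢
      rw [← mul_sub, abs_mul]
      have e1 : dist (x + s • e - t) (x + s' • e - t) = dist s s' := by
        rw [dist_sub_right, dist_add_left, dist_eq_norm, ← sub_smul, norm_smul,
          norm_single_one, mul_one, Real.dist_eq, Real.norm_eq_abs]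
      rw [e1] at h
      calc _ ≤ |η.normed volume t| * (C * dist s s') := by gcongr
        _ = _ := by
          rw [Real.coe_nnabs, abs_of_nonneg (by positivity : 0 ≤ |η.normed volume t| * (C : ℝ))]
          ring
    · exact hη.abs.mul_const _
    -- Rademacher's theorem for `ψ`, transported by the reflection `t ↦ x - t`, which preserves null
    -- sets.
    · have hae := (quasiMeasurePreserving_sub_left_of_right_invariant (volume : Measure (E d)) x).ae
        hψ.ae_differentiableAt
      filter_upwards [hae] with t ht
      have := ht.hasFDerivAt.hasLineDerivAt e
      have h2 : HasDerivAt (fun s : ℝ => ψ (x - t + s • e)) (classicalPartial i ψ (x - t)) 0 := this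
      have e2 : (fun s : ℝ => ψ (x + s • e - t)) = fun s : ℝ => ψ (x - t + s • e) := by
        funext s; congr 1; abel
      rw [← e2] at h2
      exact h2.const_mul (η.normed volume t)
  have h2 := hd.hasFDerivAt.hasLineDerivAt e
  exact HasDerivAt.unique h2 h1

open scoped Convolution in
open ContinuousLinearMap in
-- The normalized bump is a probability density, so the convolution is an average of values of `g`.
theorem abs_convolution_le {d : ℕ} (η : ContDiffBump (0 : E d)) {g : E d → ℝ} {C : ℝ}
    (hg : ∀ x, |g x| ≤ C) (x : E d) :
    |(η.normed volume ⋆[lsmul ℝ ℝ, volume] g) x| ≤ C := by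
  have := norm_integral_le_of_norm_le (μ := (volume : Measure (E d)))
    (f := fun t => (lsmul ℝ ℝ) (η.normed volume t) (g (x - t)))
    (g := fun t => η.normed volume t * C) (η.integrable_normed.mul_const C) (by
      refine Eventually.of_forall fun t => ?_
      rw [lsmul_apply, norm_smul, Real.norm_eq_abs, Real.norm_eq_abs,
        abs_of_nonneg (η.nonneg_normed t)]
      exact mul_le_mul_of_nonneg_left (hg _) (η.nonneg_normed t))
  rwa [integral_mul_const, η.integral_normed, one_mul] at this

/-- Provides the integrable majorant for the dominated convergence arguments. -/
theorem integrable_indicator_mul {d : ℕ} {Ω S : Set (E d)} {u : E d → ℝ} (C : ℝ)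
    (hu : LocallyIntegrableOn u Ω volume) (hS : IsCompact S) (hSΩ : S ⊆ Ω) :
    Integrable (S.indicator fun x => |u x| * C) (volume.restrict Ω) := by
  have h : IntegrableOn u S volume := hu.integrableOn_compact_subset hSΩ hS
  exact ((integrable_indicator_iff hS.measurableSet).2 (h.abs.mul_const C)).restrict

open scoped Convolution in
open ContinuousLinearMap in
/-- A weak derivative may be tested against compactly supported Lipschitz functions. -/
theorem HasWeakPartial.integral_lipschitz {d : ℕ} {Ω : Set (E d)} (hΩ : IsOpen Ω) {i : Fin d}
    {u g : E d → ℝ} (h : HasWeakPartial Ω i u g) {ψ : E d → ℝ} {C : NNReal}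
    (hψ : LipschitzWith C ψ) (hc : HasCompactSupport ψ) (hs : tsupport ψ ⊆ Ω) :
    ∫ x in Ω, u x * classicalPartial i ψ x = - ∫ x in Ω, g x * ψ x := by
  -- All mollifications with radius at most `δ` are supported in one compact subset of `Ω`, where
  -- `u` and `g` are integrable.
  obtain ⟨δ, hδ, hδΩ⟩ := hc.isCompact.exists_cthickening_subset_open hΩ hs
  set S := Metric.cthickening δ (tsupport ψ) with hS
  have hSc : IsCompact S := hc.isCompact.cthickening
  let η : ℕ → ContDiffBump (0 : E d) := fun n =>
    ⟨δ / (n + 1) / 2, δ / (n + 1), by positivity, half_lt_self (by positivity)⟩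
  have hηr : Tendsto (fun n => (η n).rOut) atTop (𝓝 0) :=
    tendsto_const_div_atTop_nhds_zero_nat δ |>.comp (tendsto_add_atTop_nat 1) |>.congr
      (fun n => by simp [η])
  have hηδ : ∀ n, (η n).rOut ≤ δ := fun n =>
    div_le_self hδ.le (by linarith [(Nat.cast_nonneg n : (0 : ℝ) ≤ n)])
  let Ψ : ℕ → E d → ℝ := fun n => (η n).normed volume ⋆[lsmul ℝ ℝ, volume] ψ
  obtain ⟨M, hM⟩ := hψ.continuous.bounded_above_of_compact_support hc
  have hpart : ∀ x, |classicalPartial i ψ x| ≤ C := fun x =>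
    abs_classicalPartial_le_of_lipschitzOn i univ_mem (lipschitzOnWith_univ.2 hψ)
  have hzero : ∀ n x, x ∉ S → Ψ n x = 0 := by
    intro n x hx
    refine integral_eq_zero_of_ae (Eventually.of_forall fun t => ?_)
    by_cases ht : t ∈ Metric.ball (0 : E d) (η n).rOut
    · have : ψ (x - t) = 0 := by
        by_contra hne
        refine hx (Metric.mem_cthickening_of_dist_le x (x - t) δ _ (subset_tsupport _ hne) ?_)
        rw [Metric.mem_ball, dist_zero_right] at ht
        simpa [dist_eq_norm] using ht.le.trans (hηδ n)
      simp [this]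
    · have : (η n).normed volume t = 0 := by
        rw [← Function.notMem_support, (η n).support_normed_eq]
        exact ht
      simp [this]
  have hts : ∀ n, tsupport (Ψ n) ⊆ S := fun n =>
    closure_minimal (fun x hx => by_contra fun h => hx (hzero n x h)) Metric.isClosed_cthickening
  have htest : ∀ n, IsTest Ω (Ψ n) := by
    intro n
    refine ⟨?_, ?_, (hts n).trans hδΩ⟩
    · exact ((η n).hasCompactSupport_normed (μ := (volume : Measure (E d)))).contDiff_convolution_left
        (μ := (volume : Measure (E d))) (lsmul ℝ ℝ) (η n).contDiff_normed
        hψ.continuous.locallyIntegrable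
    · exact hSc.of_isClosed_subset (isClosed_tsupport _) (hts n)
  have hzero' : ∀ n x, x ∉ S → classicalPartial i (Ψ n) x = 0 := by
    intro n x hx
    have hx' : x ∉ tsupport (fderiv ℝ (Ψ n)) :=
      fun h' => hx (hts n (tsupport_fderiv_subset ℝ h'))
    rw [classicalPartial, image_eq_zero_of_notMem_tsupport hx']
    rfl
  have hum := h.1.aestronglyMeasurable
  have hgm := h.2.1.aestronglyMeasurable
  have lim1 : Tendsto (fun n => ∫ x in Ω, u x * classicalPartial i (Ψ n) x) atTop
      (𝓝 (∫ x in Ω, u x * classicalPartial i ψ x)) := by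
    refine tendsto_integral_of_dominated_convergence (S.indicator fun x => |u x| * C)
      (fun n => hum.mul (measurable_classicalPartial i (Ψ n)).aestronglyMeasurable)
      (integrable_indicator_mul _ h.1 hSc hδΩ) (fun n => Eventually.of_forall fun x => ?_) ?_
    · by_cases hx : x ∈ S
      · rw [Set.indicator_of_mem hx, norm_mul, Real.norm_eq_abs, Real.norm_eq_abs]
        gcongr
        rw [classicalPartial_convolution i (η n) hψ x]
        exact abs_convolution_le (η n) hpart x
      · rw [Set.indicator_of_notMem hx, hzero' n x hx]; simp
    -- The derivative of `ψ` is only bounded and measurable, so its mollifications converge almost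
    -- everywhere by Lebesgue differentiation. The factor 2 below is the ratio of outer to inner
    -- radius of the bumps.
    · have hli : LocallyIntegrable (classicalPartial i ψ) (volume : Measure (E d)) :=
        (locallyIntegrable_const (C : ℝ)).mono
          (measurable_classicalPartial i ψ).aestronglyMeasurable
          (Eventually.of_forall fun x => by simpa using hpart x)
      have := ContDiffBump.ae_convolution_tendsto_right_of_locallyIntegrable (φ := η) (l := atTop)
        (K := 2) hηr (Eventually.of_forall fun n => by simp only [η]; linarith) hli
      filter_upwards [ae_restrict_of_ae this] with x hx
      refine Tendsto.const_mul _ (hx.congr fun n => ?_)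
      rw [classicalPartial_convolution i (η n) hψ x]
  have lim2 : Tendsto (fun n => ∫ x in Ω, g x * Ψ n x) atTop (𝓝 (∫ x in Ω, g x * ψ x)) := by
    refine tendsto_integral_of_dominated_convergence (S.indicator fun x => |g x| * M)
      (fun n => hgm.mul (htest n).1.continuous.aestronglyMeasurable)
      (integrable_indicator_mul _ h.2.1 hSc hδΩ) (fun n => Eventually.of_forall fun x => ?_) ?_
    · by_cases hx : x ∈ S
      · rw [Set.indicator_of_mem hx, norm_mul, Real.norm_eq_abs, Real.norm_eq_abs]
        gcongr
        exact abs_convolution_le (η n) hM x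
      · rw [Set.indicator_of_notMem hx, hzero n x hx]; simp
    · refine Eventually.of_forall fun x => Tendsto.const_mul _ ?_
      exact ContDiffBump.convolution_tendsto_right_of_continuous hηr hψ.continuous x
  refine tendsto_nhds_unique lim1 (lim2.neg.congr fun n => ?_)
  exact (h.2.2 (Ψ n) (htest n)).symm

/-! ### Weak derivatives -/

theorem IsTest.continuous_classicalPartial {φ : E d → ℝ} (hφ : IsTest Ω φ) (i : Fin d) :
    Continuous (classicalPartial i φ) :=
  (hφ.1.continuous_fderiv (by simp)).clm_apply continuous_const

theorem tsupport_classicalPartial_subset {φ : E d → ℝ} (i : Fin d) :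
    tsupport (classicalPartial i φ) ⊆ tsupport φ := by
  refine (closure_mono fun x hx => ?_).trans (tsupport_fderiv_subset ℝ (f := φ))
  rw [Function.mem_support] at hx ⊢
  intro h
  exact hx (by rw [classicalPartial, h]; rfl)

theorem IsTest.hasCompactSupport_classicalPartial {φ : E d → ℝ} (hφ : IsTest Ω φ) (i : Fin d) :
    HasCompactSupport (classicalPartial i φ) :=
  hφ.2.1.of_isClosed_subset (isClosed_tsupport _) (tsupport_classicalPartial_subset i)

theorem integrable_mul_of_compact_support {u φ : E d → ℝ}
    (hu : LocallyIntegrableOn u Ω volume) (hφ : Continuous φ) (hc : HasCompactSupport φ)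
    (hs : tsupport φ ⊆ Ω) : Integrable (fun x => u x * φ x) (volume.restrict Ω) := by
  obtain ⟨M, hM⟩ := hφ.bounded_above_of_compact_support hc
  refine (integrable_indicator_mul M hu hc.isCompact hs).mono
    (hu.aestronglyMeasurable.mul hφ.aestronglyMeasurable) (Eventually.of_forall fun x => ?_)
  by_cases hx : x ∈ tsupport φ
  · rw [Set.indicator_of_mem hx, norm_mul, norm_mul, Real.norm_eq_abs (|u x|), abs_abs,
      Real.norm_eq_abs M, Real.norm_eq_abs (u x)]
    gcongr
    exact (hM x).trans (le_abs_self M)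
  · rw [image_eq_zero_of_notMem_tsupport hx]
    simp

theorem IsTest.integrable_mul {u φ : E d → ℝ} (hφ : IsTest Ω φ)
    (hu : LocallyIntegrableOn u Ω volume) :
    Integrable (fun x => u x * φ x) (volume.restrict Ω) :=
  integrable_mul_of_compact_support hu hφ.1.continuous hφ.2.1 hφ.2.2

theorem IsTest.integrable_mul_classicalPartial {u φ : E d → ℝ} (hφ : IsTest Ω φ)
    (hu : LocallyIntegrableOn u Ω volume) (i : Fin d) :
    Integrable (fun x => u x * classicalPartial i φ x) (volume.restrict Ω) :=
  integrable_mul_of_compact_support hu (hφ.continuous_classicalPartial i)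
    (hφ.hasCompactSupport_classicalPartial i)
    ((tsupport_classicalPartial_subset i).trans hφ.2.2)

/-- The fundamental lemma of the calculus of variations, applied to the difference. -/
theorem HasWeakPartial.ae_unique (hΩ : IsOpen Ω) {i : Fin d} {u g g' : E d → ℝ}
    (h : HasWeakPartial Ω i u g) (h' : HasWeakPartial Ω i u g') :
    g =ᵐ[volume.restrict Ω] g' := by
  have hl : LocallyIntegrableOn (fun x => g x - g' x) Ω volume := h.2.1.sub h'.2.1
  have := hΩ.ae_eq_zero_of_integral_contDiff_smul_eq_zero hl (fun φ hφ hc hs => by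
    have ht : IsTest Ω φ := ⟨hφ, hc, hs⟩
    rw [← setIntegral_eq_integral_of_forall_compl_eq_zero (s := Ω)]
    · have e : ∀ x, φ x • (g x - g' x) = g x * φ x - g' x * φ x := fun x => by
        rw [smul_eq_mul]; ring
      simp_rw [e]
      rw [integral_sub (ht.integrable_mul h.2.1) (ht.integrable_mul h'.2.1)]
      have h1 := h.2.2 φ ht
      have h2 := h'.2.2 φ ht
      linarith
    · intro x hx
      rw [image_eq_zero_of_notMem_tsupport fun hx' => hx (hs hx'), zero_smul])
  filter_upwards [(ae_restrict_iff' hΩ.measurableSet).2 this] with x hx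
  linarith

/-- Since `weakPartial` is a choice, it is computed by exhibiting some weak derivative; all
identities about it therefore hold only almost everywhere. -/
theorem HasWeakPartial.weakPartial_ae_eq (hΩ : IsOpen Ω) {i : Fin d} {u g : E d → ℝ}
    (h : HasWeakPartial Ω i u g) : weakPartial Ω i u =ᵐ[volume.restrict Ω] g := by
  have hex : ∃ g, HasWeakPartial Ω i u g := ⟨g, h⟩
  rw [weakPartial, dif_pos hex]
  exact hex.choose_spec.ae_unique hΩ h

theorem MemH1.hasWeakPartial {u : E d → ℝ} (h : MemH1 Ω u) (i : Fin d) :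
    HasWeakPartial Ω i u (weakPartial Ω i u) := by
  obtain ⟨g, hg, -⟩ := h.2 i
  have hex : ∃ g, HasWeakPartial Ω i u g := ⟨g, hg⟩
  rw [weakPartial, dif_pos hex]
  exact hex.choose_spec

theorem MemH1.memLp_weakPartial (hΩ : IsOpen Ω) {u : E d → ℝ} (h : MemH1 Ω u) (i : Fin d) :
    MemLp (weakPartial Ω i u) 2 (volume.restrict Ω) := by
  obtain ⟨g, hg, hg2⟩ := h.2 i
  exact (memLp_congr_ae (hg.weakPartial_ae_eq hΩ)).2 hg2

theorem HasWeakPartial.linear_comb {i : Fin d} {u v g k : E d → ℝ}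
    (hu : HasWeakPartial Ω i u g) (hv : HasWeakPartial Ω i v k) (s t : ℝ) :
    HasWeakPartial Ω i (fun x => s * u x + t * v x) (fun x => s * g x + t * k x) := by
  refine ⟨(hu.1.smul s).add (hv.1.smul t), (hu.2.1.smul s).add (hv.2.1.smul t), fun φ hφ => ?_⟩
  have h1 := hu.2.2 φ hφ
  have h2 := hv.2.2 φ hφ
  have e1 : ∀ x, (s * u x + t * v x) * classicalPartial i φ x
      = s * (u x * classicalPartial i φ x) + t * (v x * classicalPartial i φ x) := fun x => by ring
  have e2 : ∀ x, (s * g x + t * k x) * φ x = s * (g x * φ x) + t * (k x * φ x) := fun x => by ring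
  simp_rw [e1, e2]
  rw [integral_add ((hφ.integrable_mul_classicalPartial hu.1 i).const_mul s)
      ((hφ.integrable_mul_classicalPartial hv.1 i).const_mul t),
    integral_add ((hφ.integrable_mul hu.2.1).const_mul s) ((hφ.integrable_mul hv.2.1).const_mul t)]
  simp only [integral_const_mul]
  rw [h1, h2]
  ring

theorem memLp_linear_comb {μ : Measure (E d)} {u v : E d → ℝ} (hu : MemLp u 2 μ)
    (hv : MemLp v 2 μ) (s t : ℝ) : MemLp (fun x => s * u x + t * v x) 2 μ :=
  (hu.const_mul s).add (hv.const_mul t)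

theorem MemH1.linear_comb (hΩ : IsOpen Ω) {u v : E d → ℝ} (hu : MemH1 Ω u) (hv : MemH1 Ω v)
    (s t : ℝ) : MemH1 Ω (fun x => s * u x + t * v x) :=
  ⟨memLp_linear_comb hu.1 hv.1 s t, fun i =>
    ⟨_, (hu.hasWeakPartial i).linear_comb (hv.hasWeakPartial i) s t,
      memLp_linear_comb (hu.memLp_weakPartial hΩ i) (hv.memLp_weakPartial hΩ i) s t⟩⟩

theorem MemH1.weakPartial_linear_comb (hΩ : IsOpen Ω) {u v : E d → ℝ} (hu : MemH1 Ω u)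
    (hv : MemH1 Ω v) (s t : ℝ) (i : Fin d) :
    weakPartial Ω i (fun x => s * u x + t * v x) =ᵐ[volume.restrict Ω]
      fun x => s * weakPartial Ω i u x + t * weakPartial Ω i v x :=
  ((hu.hasWeakPartial i).linear_comb (hv.hasWeakPartial i) s t).weakPartial_ae_eq hΩ

theorem isTest_zero : IsTest Ω (fun _ => 0) :=
  ⟨contDiff_const, HasCompactSupport.zero, by
    rw [show (fun _ : E d => (0 : ℝ)) = 0 from rfl, tsupport_eq_empty_iff.2 rfl]
    exact Set.empty_subset _⟩

theorem hasWeakPartial_zero (i : Fin d) : HasWeakPartial Ω i (fun _ => 0) (fun _ => 0) :=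
  ⟨locallyIntegrableOn_const 0, locallyIntegrableOn_const 0, by simp⟩

theorem memH1_zero : MemH1 Ω (fun _ => 0) :=
  ⟨MemLp.zero', fun i => ⟨_, hasWeakPartial_zero i, MemLp.zero'⟩⟩

theorem classicalPartial_zero (i : Fin d) (x : E d) :
    classicalPartial i (fun _ : E d => (0 : ℝ)) x = 0 := by
  simp [classicalPartial]

theorem memH10_zero (hΩ : IsOpen Ω) : MemH10 Ω (fun _ => 0) := by
  refine ⟨memH1_zero, fun _ _ => 0, fun _ => isTest_zero, by simp, fun i => ?_⟩
  have : eLpNorm (fun x => weakPartial Ω i (fun _ => 0) x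
      - classicalPartial i (fun _ : E d => (0 : ℝ)) x) 2 (volume.restrict Ω) = 0 := by
    rw [eLpNorm_congr_ae (g := fun _ => (0 : ℝ)), eLpNorm_zero']
    filter_upwards [(hasWeakPartial_zero i).weakPartial_ae_eq hΩ] with x hx
    rw [hx, classicalPartial_zero, sub_zero]
  simpa using this

theorem IsTest.linear_comb {φ ψ : E d → ℝ} (hφ : IsTest Ω φ) (hψ : IsTest Ω ψ) (s t : ℝ) :
    IsTest Ω (fun x => s * φ x + t * ψ x) := by
  refine ⟨(contDiff_const.mul hφ.1).add (contDiff_const.mul hψ.1),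
    (hφ.2.1.mul_left (f := fun _ => s)).add (hψ.2.1.mul_left (f := fun _ => t)), ?_⟩
  refine (tsupport_add (fun x => s * φ x) (fun x => t * ψ x)).trans (Set.union_subset ?_ ?_)
  · exact (tsupport_mul_subset_right (f := fun _ => s)).trans hφ.2.2
  · exact (tsupport_mul_subset_right (f := fun _ => t)).trans hψ.2.2

theorem IsTest.classicalPartial_linear_comb {φ ψ : E d → ℝ} (hφ : IsTest Ω φ) (hψ : IsTest Ω ψ)
    (s t : ℝ) (i : Fin d) (x : E d) :
    classicalPartial i (fun x => s * φ x + t * ψ x) x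
      = s * classicalPartial i φ x + t * classicalPartial i ψ x := by
  have h1 := (hφ.1.differentiable (by simp)) x
  have h2 := (hψ.1.differentiable (by simp)) x
  simp only [classicalPartial]
  have := (h1.hasFDerivAt.const_mul s).add (h2.hasFDerivAt.const_mul t)
  have h3 : HasFDerivAt (fun x => s * φ x + t * ψ x) (s • fderiv ℝ φ x + t • fderiv ℝ ψ x) x := this
  rw [h3.fderiv]
  simp

theorem tendsto_eLpNorm_linear_comb {μ : Measure (E d)} {u v : E d → ℝ} {p q : ℕ → E d → ℝ}
    (hu : AEStronglyMeasurable u μ) (hv : AEStronglyMeasurable v μ)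
    (hp : ∀ n, AEStronglyMeasurable (p n) μ) (hq : ∀ n, AEStronglyMeasurable (q n) μ)
    (hup : Tendsto (fun n => eLpNorm (fun x => u x - p n x) 2 μ) atTop (𝓝 0))
    (hvq : Tendsto (fun n => eLpNorm (fun x => v x - q n x) 2 μ) atTop (𝓝 0)) (s t : ℝ) :
    Tendsto (fun n => eLpNorm (fun x => (s * u x + t * v x) - (s * p n x + t * q n x)) 2 μ)
      atTop (𝓝 0) := by
  have lim : Tendsto (fun n => ‖s‖ₑ * eLpNorm (fun x => u x - p n x) 2 μ
      + ‖t‖ₑ * eLpNorm (fun x => v x - q n x) 2 μ) atTop (𝓝 0) := by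
    have := (ENNReal.Tendsto.const_mul hup (Or.inr (enorm_ne_top (x := s)))).add
      (ENNReal.Tendsto.const_mul hvq (Or.inr (enorm_ne_top (x := t))))
    simpa using this
  refine tendsto_of_tendsto_of_tendsto_of_le_of_le tendsto_const_nhds lim
    (fun _ => zero_le) fun n => ?_
  have e : (fun x => (s * u x + t * v x) - (s * p n x + t * q n x))
      = (s • fun x => u x - p n x) + (t • fun x => v x - q n x) := by
    funext x; simp only [Pi.add_apply, Pi.smul_apply, smul_eq_mul]; ring
  simp only
  rw [e]
  refine (eLpNorm_add_le ((hu.sub (hp n)).const_smul s) ((hv.sub (hq n)).const_smul t)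
    one_le_two).trans ?_
  rw [eLpNorm_const_smul, eLpNorm_const_smul]
  exact le_rfl

theorem MemH10.linear_comb (hΩ : IsOpen Ω) {u v : E d → ℝ} (hu : MemH10 Ω u) (hv : MemH10 Ω v)
    (s t : ℝ) : MemH10 Ω (fun x => s * u x + t * v x) := by
  obtain ⟨hu1, φ, hφ, hφ0, hφ1⟩ := hu
  obtain ⟨hv1, ψ, hψ, hψ0, hψ1⟩ := hv
  refine ⟨hu1.linear_comb hΩ hv1 s t, fun n x => s * φ n x + t * ψ n x,
    fun n => (hφ n).linear_comb (hψ n) s t, ?_, fun i => ?_⟩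
  · exact tendsto_eLpNorm_linear_comb hu1.1.1 hv1.1.1
      (fun n => (hφ n).1.continuous.aestronglyMeasurable)
      (fun n => (hψ n).1.continuous.aestronglyMeasurable) hφ0 hψ0 s t
  · have := tendsto_eLpNorm_linear_comb (hu1.memLp_weakPartial hΩ i).1
      (hv1.memLp_weakPartial hΩ i).1
      (fun n => (measurable_classicalPartial i (φ n)).aestronglyMeasurable)
      (fun n => (measurable_classicalPartial i (ψ n)).aestronglyMeasurable) (hφ1 i) (hψ1 i) s t
    refine this.congr fun n => eLpNorm_congr_ae ?_
    filter_upwards [hu1.weakPartial_linear_comb hΩ hv1 s t i] with x hx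
    rw [hx, (hφ n).classicalPartial_linear_comb (hψ n) s t i x]

/-! ### Locally Lipschitz multipliers -/

/-- Bounded functions which are Lipschitz, with a uniform constant, on the balls contained in `Ω`,
and differentiable almost everywhere in `Ω`. -/
structure LipReg (Ω : Set (E d)) (ρ : E d → ℝ) : Prop where
  lip : ∃ K : NNReal, ∀ x r, Metric.ball x r ⊆ Ω → LipschitzOnWith K ρ (Metric.ball x r)
  bdd : ∃ M : ℝ, ∀ x ∈ Ω, |ρ x| ≤ M
  diff : ∀ᵐ x ∂(volume.restrict Ω), DifferentiableAt ℝ ρ x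

theorem LipReg.continuousOn (hΩ : IsOpen Ω) {ρ : E d → ℝ} (h : LipReg Ω ρ) :
    ContinuousOn ρ Ω := by
  obtain ⟨K, hK⟩ := h.lip
  intro x hx
  obtain ⟨r, hr, hrΩ⟩ := Metric.isOpen_iff.1 hΩ x hx
  exact ((hK x r hrΩ).continuousOn.continuousAt (Metric.ball_mem_nhds x hr)).continuousWithinAt

theorem LipReg.aestronglyMeasurable (hΩ : IsOpen Ω) {ρ : E d → ℝ} (h : LipReg Ω ρ) :
    AEStronglyMeasurable ρ (volume.restrict Ω) :=
  (h.continuousOn hΩ).aestronglyMeasurable hΩ.measurableSet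

theorem LipReg.memLp_top (hΩ : IsOpen Ω) {ρ : E d → ℝ} (h : LipReg Ω ρ) :
    MemLp ρ ⊤ (volume.restrict Ω) := by
  obtain ⟨M, hM⟩ := h.bdd
  exact memLp_top_of_bound (h.aestronglyMeasurable hΩ) M (ae_restrict_of_forall_mem
    hΩ.measurableSet hM)

theorem LipReg.exists_abs_classicalPartial_le (hΩ : IsOpen Ω) {ρ : E d → ℝ} (h : LipReg Ω ρ)
    (i : Fin d) : ∃ K : ℝ, ∀ x ∈ Ω, |classicalPartial i ρ x| ≤ K := by
  obtain ⟨K, hK⟩ := h.lip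
  refine ⟨K, fun x hx => ?_⟩
  obtain ⟨r, hr, hrΩ⟩ := Metric.isOpen_iff.1 hΩ x hx
  exact abs_classicalPartial_le_of_lipschitzOn i (Metric.ball_mem_nhds x hr) (hK x r hrΩ)

theorem LipReg.memLp_top_classicalPartial (hΩ : IsOpen Ω) {ρ : E d → ℝ} (h : LipReg Ω ρ)
    (i : Fin d) : MemLp (classicalPartial i ρ) ⊤ (volume.restrict Ω) := by
  obtain ⟨K, hK⟩ := h.exists_abs_classicalPartial_le hΩ i
  exact memLp_top_of_bound (measurable_classicalPartial i ρ).aestronglyMeasurable K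
    (ae_restrict_of_forall_mem hΩ.measurableSet hK)

theorem memLp_top_mul {μ : Measure (E d)} {m u : E d → ℝ} (hm : MemLp m ⊤ μ) (hu : MemLp u 2 μ) :
    MemLp (fun x => m x * u x) 2 μ :=
  MemLp.mul hu hm

theorem locallyIntegrableOn_bdd_mul {m u : E d → ℝ}
    (hm : AEStronglyMeasurable m (volume.restrict Ω)) {K : ℝ} (hK : ∀ x ∈ Ω, |m x| ≤ K)
    (hΩ : IsOpen Ω) (hu : LocallyIntegrableOn u Ω volume) :
    LocallyIntegrableOn (fun x => m x * u x) Ω volume := by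
  intro x hx
  obtain ⟨s, hs, hsu⟩ := hu x hx
  refine ⟨s ∩ Ω, inter_mem hs self_mem_nhdsWithin, ?_⟩
  refine Integrable.bdd_mul (c := K) (hsu.mono_set Set.inter_subset_left)
    (hm.mono_measure (Measure.restrict_mono Set.inter_subset_right le_rfl)) ?_
  have : ∀ᵐ y ∂(volume.restrict Ω), ‖m y‖ ≤ K := ae_restrict_of_forall_mem hΩ.measurableSet hK
  exact ae_restrict_of_ae_restrict_of_subset Set.inter_subset_right this

/-- For a test function `φ`, the product `ρ φ` is Lipschitz with compact support in `Ω`, hence an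
admissible test function for `u`. Expanding its derivative, which is legitimate almost everywhere,
gives the product rule. -/
theorem HasWeakPartial.mul_lipReg (hΩ : IsOpen Ω) {i : Fin d} {u g ρ : E d → ℝ}
    (hu : HasWeakPartial Ω i u g) (hρ : LipReg Ω ρ) :
    HasWeakPartial Ω i (fun x => ρ x * u x)
      (fun x => classicalPartial i ρ x * u x + ρ x * g x) := by
  obtain ⟨K, hK⟩ := hρ.lip
  obtain ⟨M, hM⟩ := hρ.bdd
  obtain ⟨K', hK'⟩ := hρ.exists_abs_classicalPartial_le hΩ i
  have i1 : LocallyIntegrableOn (fun x => ρ x * u x) Ω volume :=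
    locallyIntegrableOn_bdd_mul (hρ.aestronglyMeasurable hΩ) hM hΩ hu.1
  have i2 : LocallyIntegrableOn (fun x => ρ x * g x) Ω volume :=
    locallyIntegrableOn_bdd_mul (hρ.aestronglyMeasurable hΩ) hM hΩ hu.2.1
  have i3 : LocallyIntegrableOn (fun x => classicalPartial i ρ x * u x) Ω volume :=
    locallyIntegrableOn_bdd_mul (measurable_classicalPartial i ρ).aestronglyMeasurable hK' hΩ hu.1
  refine ⟨i1, i3.add i2, fun φ hφ => ?_⟩
  obtain ⟨L, hL⟩ := hφ.1.lipschitzWith_of_hasCompactSupport hφ.2.1 (by simp)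
  obtain ⟨C, hC⟩ := exists_lipschitzWith_mul hΩ hK hM hL hφ.2.1 hφ.2.2
  have key := hu.integral_lipschitz hΩ hC (hφ.2.1.mul_left)
    ((tsupport_mul_subset_right (f := ρ)).trans hφ.2.2)
  have e1 : ∫ x in Ω, u x * classicalPartial i (fun x => ρ x * φ x) x
      = ∫ x in Ω, ((ρ x * u x) * classicalPartial i φ x
          + (classicalPartial i ρ x * u x) * φ x) := by
    refine integral_congr_ae ?_
    filter_upwards [hρ.diff] with x hx
    have hφx := (hφ.1.differentiable (by simp)) x
    have h3 := hx.hasFDerivAt.mul hφx.hasFDerivAt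
    have h4 : HasFDerivAt (fun x => ρ x * φ x) (ρ x • fderiv ℝ φ x + φ x • fderiv ℝ ρ x) x := h3
    simp only [classicalPartial]
    rw [h4.fderiv]
    simp only [_root_.add_apply, _root_.smul_apply, smul_eq_mul]
    ring
  rw [e1, integral_add (hφ.integrable_mul_classicalPartial i1 i) (hφ.integrable_mul i3)] at key
  have e2 : ∀ x, (classicalPartial i ρ x * u x + ρ x * g x) * φ x
      = (classicalPartial i ρ x * u x) * φ x + (ρ x * g x) * φ x := fun x => by ring
  simp_rw [e2]
  rw [integral_add (hφ.integrable_mul i3) (hφ.integrable_mul i2)]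
  have e3 : ∫ x in Ω, g x * (ρ x * φ x) = ∫ x in Ω, (ρ x * g x) * φ x :=
    integral_congr_ae (Eventually.of_forall fun x => by ring)
  rw [e3] at key
  linarith

/-- Inserted as `u = 1` in the product rule, this identifies the weak derivatives of a `LipReg`
function with its classical ones. -/
theorem hasWeakPartial_one (i : Fin d) : HasWeakPartial Ω i (fun _ => 1) (fun _ => 0) := by
  refine ⟨locallyIntegrableOn_const 1, locallyIntegrableOn_const 0, fun φ hφ => ?_⟩
  obtain ⟨L, hL⟩ := hφ.1.lipschitzWith_of_hasCompactSupport hφ.2.1 (by simp)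
  have h := (LipschitzWith.const (1 : ℝ)).integral_lineDeriv_mul_eq (μ := (volume : Measure (E d)))
    hL hφ.2.1 (-EuclideanSpace.single i 1)
  rw [setIntegral_eq_integral_of_forall_compl_eq_zero]
  · have e : ∀ x, lineDeriv ℝ φ x (EuclideanSpace.single i 1) = classicalPartial i φ x := fun x =>
      ((hφ.1.differentiable (by simp)) x).lineDeriv_eq_fderiv
    have e' : ∀ x, lineDeriv ℝ (fun _ : E d => (1 : ℝ)) x (-EuclideanSpace.single i 1) = 0 :=
      fun x => by simp [lineDeriv]
    simp only [neg_neg, e, e', zero_mul, integral_zero, mul_one] at h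
    simpa using h.symm
  · intro x hx
    rw [image_eq_zero_of_notMem_tsupport
      fun hx' => hx (hφ.2.2 (tsupport_classicalPartial_subset i hx')), mul_zero]

theorem LipReg.hasWeakPartial (hΩ : IsOpen Ω) {ρ : E d → ℝ} (hρ : LipReg Ω ρ) (i : Fin d) :
    HasWeakPartial Ω i ρ (classicalPartial i ρ) := by
  simpa using (hasWeakPartial_one i).mul_lipReg hΩ hρ

theorem LipReg.memH1 (hΩ : IsOpen Ω) [IsFiniteMeasure (volume.restrict Ω)] {ρ : E d → ℝ}
    (hρ : LipReg Ω ρ) : MemH1 Ω ρ :=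
  ⟨(hρ.memLp_top hΩ).mono_exponent le_top, fun i => ⟨_, hρ.hasWeakPartial hΩ i,
    (hρ.memLp_top_classicalPartial hΩ i).mono_exponent le_top⟩⟩

theorem LipReg.weakPartial_ae_eq (hΩ : IsOpen Ω) {ρ : E d → ℝ} (hρ : LipReg Ω ρ) (i : Fin d) :
    weakPartial Ω i ρ =ᵐ[volume.restrict Ω] classicalPartial i ρ :=
  (hρ.hasWeakPartial hΩ i).weakPartial_ae_eq hΩ

theorem MemH1.mul_lipReg (hΩ : IsOpen Ω) {u ρ : E d → ℝ} (hu : MemH1 Ω u) (hρ : LipReg Ω ρ) :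
    MemH1 Ω (fun x => ρ x * u x) :=
  ⟨memLp_top_mul (hρ.memLp_top hΩ) hu.1, fun i =>
    ⟨_, (hu.hasWeakPartial i).mul_lipReg hΩ hρ,
      (memLp_top_mul (hρ.memLp_top_classicalPartial hΩ i) hu.1).add
        (memLp_top_mul (hρ.memLp_top hΩ) (hu.memLp_weakPartial hΩ i))⟩⟩

theorem MemH1.weakPartial_mul_lipReg (hΩ : IsOpen Ω) {u ρ : E d → ℝ} (hu : MemH1 Ω u)
    (hρ : LipReg Ω ρ) (i : Fin d) :
    weakPartial Ω i (fun x => ρ x * u x) =ᵐ[volume.restrict Ω]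
      fun x => weakPartial Ω i ρ x * u x + ρ x * weakPartial Ω i u x := by
  filter_upwards [((hu.hasWeakPartial i).mul_lipReg hΩ hρ).weakPartial_ae_eq hΩ,
    hρ.weakPartial_ae_eq hΩ i] with x h1 h2
  rw [h1, h2]

/-! ### Integration by parts -/

theorem tendsto_integral_mul_of_tendsto_eLpNorm {μ : Measure (E d)} {f u : E d → ℝ}
    {p : ℕ → E d → ℝ} (hf : MemLp f 2 μ) (hu : MemLp u 2 μ) (hp : ∀ n, MemLp (p n) 2 μ)
    (h : Tendsto (fun n => eLpNorm (fun x => u x - p n x) 2 μ) atTop (𝓝 0)) :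
    Tendsto (fun n => ∫ x, f x * p n x ∂μ) atTop (𝓝 (∫ x, f x * u x ∂μ)) := by
  refine tendsto_integral_of_L1' (fun x => f x * u x) (hf.1.mul hu.1)
    (Eventually.of_forall fun n => hf.integrable_mul (hp n)) ?_
  have lim := ENNReal.Tendsto.const_mul h (Or.inr hf.eLpNorm_ne_top)
  rw [mul_zero] at lim
  refine tendsto_of_tendsto_of_tendsto_of_le_of_le tendsto_const_nhds lim
    (fun _ => zero_le) fun n => ?_
  have e : ((fun x => f x * p n x) - fun x => f x * u x) = -(f • fun x => u x - p n x) := by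
    funext x
    simp only [Pi.sub_apply, Pi.neg_apply, smul_eq_mul, Pi.mul_apply]; ring
  simp only
  rw [e, eLpNorm_neg]
  exact eLpNorm_smul_le_mul_eLpNorm (hu.1.sub (hp n).1) hf.1

theorem IsTest.memLp {φ : E d → ℝ} (hφ : IsTest Ω φ) : MemLp φ 2 (volume.restrict Ω) :=
  hφ.1.continuous.memLp_of_hasCompactSupport hφ.2.1

theorem IsTest.memLp_classicalPartial {φ : E d → ℝ} (hφ : IsTest Ω φ) (i : Fin d) :
    MemLp (classicalPartial i φ) 2 (volume.restrict Ω) :=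
  (hφ.continuous_classicalPartial i).memLp_of_hasCompactSupport
    (hφ.hasCompactSupport_classicalPartial i)

/-- This is the definition of the weak derivative when `φ` is a test function. Both sides are
continuous in `φ` for the H¹ norm, so it passes to the limit. -/
theorem MemH1.integral_weakPartial_mul (hΩ : IsOpen Ω) {U φ : E d → ℝ} (hU : MemH1 Ω U)
    (hφ : MemH10 Ω φ) (i : Fin d) :
    ∫ x in Ω, weakPartial Ω i U x * φ x = - ∫ x in Ω, U x * weakPartial Ω i φ x := by
  obtain ⟨hφ1, ψ, hψ, h0, h1⟩ := hφ
  have l1 := tendsto_integral_mul_of_tendsto_eLpNorm (hU.memLp_weakPartial hΩ i) hφ1.1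
    (fun n => (hψ n).memLp) h0
  have l2 := tendsto_integral_mul_of_tendsto_eLpNorm hU.1 (hφ1.memLp_weakPartial hΩ i)
    (fun n => (hψ n).memLp_classicalPartial i) (h1 i)
  refine tendsto_nhds_unique l1 (l2.neg.congr fun n => ?_)
  rw [(hU.hasWeakPartial i).2.2 (ψ n) (hψ n), neg_neg]

/-- The skew-symmetry of the convection term, in one direction and for one component. -/
theorem MemH1.integral_convection (hΩ : IsOpen Ω) {U v : E d → ℝ} (hU : MemH1 Ω U)
    (hv : LipReg Ω v) (hv0 : MemH10 Ω v) (i : Fin d) :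
    ∫ x in Ω, (weakPartial Ω i U x * (v x * v x) + 2 * (U x * weakPartial Ω i v x * v x)) = 0 := by
  -- Integrating the product `v U` against `v`, rather than `U` against `v²`, avoids having to show
  -- that `v²` lies in H¹₀.
  have h := (hU.mul_lipReg hΩ hv).integral_weakPartial_mul hΩ hv0 i
  have hUv := memLp_top_mul (hv.memLp_top hΩ) hU.1
  have h1 : Integrable (fun x => v x * U x * weakPartial Ω i v x) (volume.restrict Ω) :=
    hUv.integrable_mul (hv0.1.memLp_weakPartial hΩ i)
  have h2 : Integrable (fun x => weakPartial Ω i (fun x => v x * U x) x * v x)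
      (volume.restrict Ω) :=
    ((hU.mul_lipReg hΩ hv).memLp_weakPartial hΩ i).integrable_mul hv0.1.1
  rw [eq_neg_iff_add_eq_zero, ← integral_add h2 h1] at h
  rw [← h]
  refine integral_congr_ae ?_
  filter_upwards [hU.weakPartial_mul_lipReg hΩ hv i] with x hx
  rw [hx]
  ring

/-! ### Functions on the closure of the domain -/

theorem ext_apply_of_mem {F : Type} [Zero F] (v : closure Ω → F) {x : E d} (hx : x ∈ closure Ω) :
    ext v x = v ⟨x, hx⟩ :=
  Subtype.val_injective.extend_apply v 0 ⟨x, hx⟩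

theorem ext_apply_of_notMem {F : Type} [Zero F] (v : closure Ω → F) {x : E d}
    (hx : x ∉ closure Ω) : ext v x = 0 :=
  Function.extend_apply' (f := Subtype.val) v 0 x fun ⟨a, ha⟩ => hx (ha ▸ a.2)

theorem continuousOn_ext {F : Type} [Zero F] [TopologicalSpace F] (v : C(closure Ω, F)) :
    ContinuousOn (ext v) (closure Ω) := by
  rw [continuousOn_iff_continuous_domRestrict]
  convert! v.continuous using 1
  funext x
  exact ext_apply_of_mem v x.2

/-! ### Geometry of the elements -/

theorem Elt.isCompact_carrier (κ : Elt d) : IsCompact κ.carrier :=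
  (Set.finite_range _).isCompact_convexHull _

theorem Elt.convex_carrier (κ : Elt d) : Convex ℝ κ.carrier := convex_convexHull ℝ _

theorem Elt.isClosed_carrier (κ : Elt d) : IsClosed κ.carrier := κ.isCompact_carrier.isClosed

theorem Elt.mem_carrier_iff (κ : Elt d) {x : E d} : x ∈ κ.carrier ↔ ∀ i, 0 ≤ κ.coord i x := by
  change x ∈ convexHull ℝ (Set.range κ) ↔ _
  rw [AffineBasis.convexHull_eq_nonneg_coord]
  rfl

theorem Elt.mem_interior_iff (κ : Elt d) {x : E d} :
    x ∈ interior κ.carrier ↔ ∀ i, 0 < κ.coord i x := by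
  change x ∈ interior (convexHull ℝ (Set.range κ)) ↔ _
  rw [AffineBasis.interior_convexHull]
  rfl

theorem Elt.nonempty_interior (κ : Elt d) : (interior κ.carrier).Nonempty :=
  ⟨_, AffineBasis.centroid_mem_interior_convexHull κ⟩

theorem Elt.contDiff_bubble (κ : Elt d) : ContDiff ℝ ∞ κ.bubble := by
  unfold Elt.bubble
  exact contDiff_prod fun i _ => (smooth_barycentric_coord κ i).of_le le_top

theorem Triangulation.carrier_subset (T : Triangulation Ω) {κ : Elt d} (hκ : κ ∈ T.elts) :
    κ.carrier ⊆ closure Ω := by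
  rw [← T.union]
  exact Set.subset_biUnion_of_mem hκ

theorem Triangulation.isCompact_closure (T : Triangulation Ω) : IsCompact (closure Ω) := by
  rw [← T.union]
  exact T.elts.isCompact_biUnion fun κ _ => κ.isCompact_carrier

theorem Triangulation.exists_mem (T : Triangulation Ω) {x : E d} (hx : x ∈ closure Ω) :
    ∃ κ ∈ T.elts, x ∈ κ.carrier := by
  rw [← T.union] at hx
  simpa using hx

theorem Triangulation.isFiniteMeasure (T : Triangulation Ω) :
    IsFiniteMeasure (volume.restrict Ω) :=
  isFiniteMeasure_restrict.2
    ((measure_mono subset_closure).trans_lt T.isCompact_closure.measure_lt_top).ne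

theorem Triangulation.interior_subset (T : Triangulation Ω) (hΩr : interior (closure Ω) = Ω)
    {κ : Elt d} (hκ : κ ∈ T.elts) : interior κ.carrier ⊆ Ω := by
  rw [← hΩr]
  exact interior_mono (T.carrier_subset hκ)

/-- The boundary of a convex set is Lebesgue-null. -/
theorem Elt.ae_mem_interior_or_notMem (κ : Elt d) :
    ∀ᵐ x ∂(volume : Measure (E d)), x ∈ interior κ.carrier ∨ x ∉ κ.carrier := by
  have h : volume (frontier κ.carrier) = 0 := κ.convex_carrier.addHaar_frontier volume
  filter_upwards [compl_mem_ae_iff.2 h] with x hx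
  by_contra hcon
  push Not at hcon
  exact hx ⟨subset_closure hcon.2, hcon.1⟩

theorem Triangulation.ae_exists_mem_interior (T : Triangulation Ω) (hΩ : IsOpen Ω) :
    ∀ᵐ x ∂(volume.restrict Ω), ∃ κ ∈ T.elts, x ∈ interior κ.carrier := by
  have h : ∀ᵐ x ∂(volume : Measure (E d)), ∀ κ ∈ T.elts, x ∈ interior κ.carrier ∨ x ∉ κ.carrier :=
    (Finset.eventually_all T.elts).2 fun κ _ => κ.ae_mem_interior_or_notMem
  filter_upwards [ae_restrict_of_ae h, ae_restrict_mem hΩ.measurableSet] with x hx hxΩ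
  obtain ⟨κ, hκ, hxκ⟩ := T.exists_mem (subset_closure hxΩ)
  exact ⟨κ, hκ, (hx κ hκ).resolve_right fun h => h hxκ⟩

/-! ### Local spaces -/

theorem exists_single_of_degree_eq_one {m : Fin d →₀ ℕ} (h : m.degree = 1) :
    ∃ i, Finsupp.single i 1 = m := by
  rw [Finsupp.degree_eq_sum] at h
  obtain ⟨i, -, hi⟩ := Finset.exists_ne_zero_of_sum_ne_zero (by rw [h]; exact one_ne_zero)
  have hs := Finset.add_sum_erase Finset.univ (fun j => m j) (Finset.mem_univ i)
  rw [h] at hs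
  refine ⟨i, Finsupp.ext fun j => ?_⟩
  rcases eq_or_ne i j with rfl | hij
  · rw [Finsupp.single_eq_same]
    omega
  · have hj := Finset.single_le_sum (f := fun j => m j) (fun _ _ => Nat.zero_le _)
      (Finset.mem_erase.2 ⟨hij.symm, Finset.mem_univ j⟩)
    rw [Finsupp.single_eq_of_ne hij.symm]
    omega

theorem exists_affine_of_totalDegree_le_one {p : MvPolynomial (Fin d) ℝ}
    (hp : p.totalDegree ≤ 1) : ∃ (a₀ : ℝ) (a : Fin d → ℝ), ∀ y : Fin d → ℝ,
      MvPolynomial.eval y p = a₀ + ∑ i, a i * y i := by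
  classical
  refine ⟨p.coeff 0, fun i => p.coeff (Finsupp.single i 1), fun y => ?_⟩
  set S : Finset (Fin d →₀ ℕ) :=
    insert 0 (Finset.univ.image fun i : Fin d => Finsupp.single i 1) with hS
  have hsub : p.support ⊆ S := by
    intro m hm
    have hdeg : m.degree ≤ 1 := by
      have := MvPolynomial.le_totalDegree hm
      rw [Finsupp.degree_eq_sum]
      rw [Finsupp.sum_fintype _ _ (by simp)] at this
      exact this.trans hp
    rw [hS, Finset.mem_insert, Finset.mem_image]
    rcases Nat.le_one_iff_eq_zero_or_eq_one.1 hdeg with h | h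
    · exact Or.inl ((Finsupp.degree_eq_zero_iff m).1 h)
    · obtain ⟨i, hi⟩ := exists_single_of_degree_eq_one h
      exact Or.inr ⟨i, Finset.mem_univ i, hi⟩
  rw [MvPolynomial.eval_eq', Finset.sum_subset hsub fun m _ hm => by
    rw [MvPolynomial.notMem_support_iff.1 hm, zero_mul], hS, Finset.sum_insert]
  · rw [Finset.sum_image fun i _ j _ h => Finsupp.single_left_injective one_ne_zero h]
    congr 1
    · simp
    · refine Finset.sum_congr rfl fun i _ => ?_
      congr 1
      rw [Finset.prod_eq_single i]
      · simp
      · intro j _ hj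
        simp [hj.symm]
      · simp
  · rw [Finset.mem_image]
    rintro ⟨i, -, hi⟩
    have := DFunLike.congr_fun hi i
    simp at this

/-- The function `a₀ + ∑ aᵢ xᵢ + c b_κ`. -/
def Elt.mini (κ : Elt d) (a₀ : ℝ) (a : Fin d → ℝ) (c : ℝ) (x : E d) : ℝ :=
  a₀ + ∑ i, a i * x i + c * κ.bubble x

theorem Elt.contDiff_mini (κ : Elt d) (a₀ : ℝ) (a : Fin d → ℝ) (c : ℝ) :
    ContDiff ℝ ∞ (κ.mini a₀ a c) := by
  have := κ.contDiff_bubble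
  unfold Elt.mini
  fun_prop

theorem IsMiniOn.exists_mini {κ : Elt d} {g : E d → ℝ} (h : IsMiniOn κ g) :
    ∃ a₀ a c, Set.EqOn g (κ.mini a₀ a c) κ.carrier := by
  obtain ⟨p, hp, c, hg⟩ := h
  obtain ⟨a₀, a, ha⟩ := exists_affine_of_totalDegree_le_one hp
  exact ⟨a₀, a, c, fun x hx => by rw [hg x hx, ha, Elt.mini]⟩

theorem IsP1On.exists_mini {κ : Elt d} {g : E d → ℝ} (h : IsP1On κ.carrier g) :
    ∃ a₀ a, Set.EqOn g (κ.mini a₀ a 0) κ.carrier := by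
  obtain ⟨p, hp, hg⟩ := h
  obtain ⟨a₀, a, ha⟩ := exists_affine_of_totalDegree_le_one hp
  exact ⟨a₀, a, fun x hx => by rw [hg x hx, ha, Elt.mini, zero_mul, add_zero]⟩

theorem IsP1On.isMiniOn {κ : Elt d} {g : E d → ℝ} (h : IsP1On κ.carrier g) : IsMiniOn κ g := by
  obtain ⟨p, hp, hg⟩ := h
  exact ⟨p, hp, 0, fun x hx => by rw [hg x hx, zero_mul, add_zero]⟩

theorem totalDegree_linear_comb_le {p q : MvPolynomial (Fin d) ℝ} (hp : p.totalDegree ≤ 1)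
    (hq : q.totalDegree ≤ 1) (s t : ℝ) : (s • p + t • q).totalDegree ≤ 1 :=
  (MvPolynomial.totalDegree_add _ _).trans (max_le
    ((MvPolynomial.totalDegree_smul_le _ _).trans hp)
    ((MvPolynomial.totalDegree_smul_le _ _).trans hq))

theorem IsP1On.linear_comb {K : Set (E d)} {g k : E d → ℝ} (hg : IsP1On K g) (hk : IsP1On K k)
    (s t : ℝ) : IsP1On K (fun x => s * g x + t * k x) := by
  obtain ⟨p, hp, hg⟩ := hg
  obtain ⟨q, hq, hk⟩ := hk
  refine ⟨s • p + t • q, totalDegree_linear_comb_le hp hq s t, fun x hx => ?_⟩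
  simp only [hg x hx, hk x hx]
  rw [map_add, MvPolynomial.smul_eval, MvPolynomial.smul_eval]

theorem IsMiniOn.linear_comb {κ : Elt d} {g k : E d → ℝ} (hg : IsMiniOn κ g) (hk : IsMiniOn κ k)
    (s t : ℝ) : IsMiniOn κ (fun x => s * g x + t * k x) := by
  obtain ⟨p, hp, c, hg⟩ := hg
  obtain ⟨q, hq, e, hk⟩ := hk
  refine ⟨s • p + t • q, totalDegree_linear_comb_le hp hq s t, s * c + t * e, fun x hx => ?_⟩
  simp only [hg x hx, hk x hx]
  rw [map_add, MvPolynomial.smul_eval, MvPolynomial.smul_eval]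
  ring

theorem isP1On_zero {K : Set (E d)} : IsP1On K (fun _ => 0) := ⟨0, by simp, by simp⟩

theorem isMiniOn_zero {κ : Elt d} : IsMiniOn κ (fun _ => 0) := (isP1On_zero).isMiniOn

theorem IsMiniOn.exists_lipschitzOnWith {κ : Elt d} {g : E d → ℝ} (h : IsMiniOn κ g) :
    ∃ K, LipschitzOnWith K g κ.carrier := by
  obtain ⟨a₀, a, c, hg⟩ := h.exists_mini
  have := ((κ.contDiff_mini a₀ a c).of_le (by simp : (1 : WithTop ℕ∞) ≤ ∞)).locallyLipschitz
  obtain ⟨K, hK⟩ := (this.locallyLipschitzOn (s := κ.carrier)).exists_lipschitzOnWith_of_compact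
    κ.isCompact_carrier
  exact ⟨K, fun x hx y hy => by rw [hg hx, hg hy]; exact hK hx hy⟩

/-- Continuous functions that are piecewise in the local spaces of the mini-element are admissible
multipliers. -/
theorem Triangulation.lipReg (T : Triangulation Ω) (hΩ : IsOpen Ω) {g : E d → ℝ}
    (hc : ContinuousOn g (closure Ω)) (hg : ∀ κ ∈ T.elts, IsMiniOn κ g) : LipReg Ω g := by
  classical
  choose! K hK using fun κ hκ => (hg κ hκ).exists_lipschitzOnWith
  -- The sum dominates each elementwise Lipschitz constant. Convexity of the ball transfers the
  -- bound across elements, along segments.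
  refine ⟨⟨∑ κ ∈ T.elts, K κ, fun x r hb => ?_⟩, ?_, ?_⟩
  · refine lipschitzOnWith_of_finite_closed_cover (convex_ball x r)
      (hc.mono (hb.trans subset_closure)) T.elts (fun κ => κ.carrier)
      (fun κ _ => κ.isClosed_carrier) ?_ fun κ hκ => ?_
    · rw [T.union]; exact hb.trans subset_closure
    · exact ((hK κ hκ).mono Set.inter_subset_right).weaken
        (Finset.single_le_sum (f := K) (fun _ _ => zero_le) hκ)
  · obtain ⟨M, hM⟩ := T.isCompact_closure.exists_bound_of_continuousOn hc
    exact ⟨M, fun x hx => hM x (subset_closure hx)⟩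
  · filter_upwards [T.ae_exists_mem_interior hΩ] with x ⟨κ, hκ, hx⟩
    obtain ⟨a₀, a, c, hga⟩ := (hg κ hκ).exists_mini
    have : g =ᶠ[𝓝 x] κ.mini a₀ a c :=
      hga.eventuallyEq_of_mem (mem_interior_iff_mem_nhds.1 hx)
    exact this.differentiableAt_iff.2
      ((κ.contDiff_mini a₀ a c).differentiable (by simp) x)

theorem Elt.classicalPartial_mini_zero (κ : Elt d) (a₀ : ℝ) (a : Fin d → ℝ) (i : Fin d)
    (x : E d) : classicalPartial i (κ.mini a₀ a 0) x = a i := by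
  have h : κ.mini a₀ a 0 = fun x =>
      a₀ + (∑ i, a i • EuclideanSpace.proj (𝕜 := ℝ) i : E d →L[ℝ] ℝ) x := by
    funext x
    simp [Elt.mini]
  have h2 : HasFDerivAt (κ.mini a₀ a 0)
      (∑ i, a i • EuclideanSpace.proj (𝕜 := ℝ) i : E d →L[ℝ] ℝ) x := by
    rw [h]
    exact (ContinuousLinearMap.hasFDerivAt _).const_add a₀
  rw [classicalPartial, h2.fderiv]
  simp

/-! ### Bubble functions -/

/-- The bubble function of `κ`, extended by zero. -/
def Elt.bub (κ : Elt d) : E d → ℝ := κ.carrier.indicator κ.bubble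

theorem Elt.bub_of_mem (κ : Elt d) {x : E d} (hx : x ∈ κ.carrier) : κ.bub x = κ.bubble x :=
  Set.indicator_of_mem hx _

theorem Elt.bub_of_notMem (κ : Elt d) {x : E d} (hx : x ∉ κ.carrier) : κ.bub x = 0 :=
  Set.indicator_of_notMem hx _

theorem Elt.bub_nonneg (κ : Elt d) (x : E d) : 0 ≤ κ.bub x :=
  Set.indicator_nonneg (fun _ hx => Finset.prod_nonneg fun i _ => κ.mem_carrier_iff.1 hx i) x

theorem Elt.bub_pos (κ : Elt d) {x : E d} (hx : x ∈ interior κ.carrier) : 0 < κ.bub x := by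
  rw [κ.bub_of_mem (interior_subset hx)]
  exact Finset.prod_pos fun i _ => κ.mem_interior_iff.1 hx i

theorem Elt.bub_eq_zero (κ : Elt d) {x : E d} (hx : x ∉ interior κ.carrier) : κ.bub x = 0 := by
  by_cases h : x ∈ κ.carrier
  · rw [κ.bub_of_mem h]
    rw [κ.mem_interior_iff] at hx
    push Not at hx
    obtain ⟨i, hi⟩ := hx
    exact Finset.prod_eq_zero (Finset.mem_univ i) (le_antisymm hi (κ.mem_carrier_iff.1 h i))
  · exact κ.bub_of_notMem h

theorem Elt.continuous_bub (κ : Elt d) : Continuous κ.bub := by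
  refine continuous_indicator (fun x hx => ?_) κ.contDiff_bubble.continuous.continuousOn
  rw [← κ.bub_of_mem (κ.isClosed_carrier.frontier_subset hx)]
  exact κ.bub_eq_zero hx.2

theorem Elt.bub_eventuallyEq (κ : Elt d) {x : E d} (hx : x ∈ interior κ.carrier) :
    κ.bub =ᶠ[𝓝 x] κ.bubble := by
  filter_upwards [mem_interior_iff_mem_nhds.1 hx] with y hy using κ.bub_of_mem hy

/-- On another element the extended bubble vanishes. Conformity puts the intersection in the hull of
the common vertices; some vertex of `κ` is not among them, and its barycentric coordinate is zero on
that hull. -/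
theorem Triangulation.isMiniOn_bub (T : Triangulation Ω) {κ κ' : Elt d} (hκ : κ ∈ T.elts)
    (hκ' : κ' ∈ T.elts) : IsMiniOn κ' κ.bub := by
  by_cases h : κ = κ'
  · subst h
    exact ⟨0, by simp, 1, fun x hx => by simp [κ.bub_of_mem hx]⟩
  · refine ⟨0, by simp, 0, fun x hx => ?_⟩
    rw [map_zero, zero_mul, add_zero]
    by_cases hxκ : x ∈ κ.carrier
    · have hx' : x ∈ convexHull ℝ (κ.vertices ∩ κ'.vertices) := by
        rw [← T.inter κ hκ κ' hκ' h]
        exact ⟨hxκ, hx⟩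
      have hi : ∃ i, κ i ∉ κ'.vertices := by
        by_contra hcon
        push Not at hcon
        have hsub : κ.vertices ⊆ κ'.vertices := by
          rintro _ ⟨i, rfl⟩
          exact hcon i
        -- Both vertex sets have `d + 1` points, so an inclusion would be an equality and the two
        -- elements would coincide.
        have hcard : ∀ τ : Elt d, τ.vertices.ncard = d + 1 := fun τ => by
          rw [Elt.vertices, ← Set.image_univ, Set.ncard_image_of_injective _ τ.ind.injective,
            Set.ncard_univ, Nat.card_fin]
        have heq := Set.eq_of_subset_of_ncard_le hsub (by rw [hcard, hcard])
          (Set.finite_range _)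
        exact h (T.injOn hκ hκ' heq)
      obtain ⟨i, hi⟩ := hi
      have hconv : Convex ℝ {y : E d | κ.coord i y = 0} := by
        have := (convex_singleton (𝕜 := ℝ) (0 : ℝ)).affine_preimage (κ.coord i)
        exact this
      have hz : x ∈ {y : E d | κ.coord i y = 0} := by
        refine convexHull_min ?_ hconv hx'
        rintro _ ⟨⟨j, rfl⟩, hj⟩
        have hij : i ≠ j := fun hij => hi (hij ▸ hj)
        exact κ.coord_apply_ne hij
      rw [κ.bub_of_mem hxκ]
      exact Finset.prod_eq_zero (Finset.mem_univ i) hz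
    · exact κ.bub_of_notMem hxκ

theorem Triangulation.lipReg_bub (T : Triangulation Ω) (hΩ : IsOpen Ω) {κ : Elt d}
    (hκ : κ ∈ T.elts) : LipReg Ω κ.bub :=
  T.lipReg hΩ κ.continuous_bub.continuousOn fun _ hκ' => T.isMiniOn_bub hκ hκ'

/-! ### Approximation of the bubbles by test functions. -/

/-- A smooth function vanishing near zero and close to the identity. -/
def cutId (y : ℝ) : ℝ := y * Real.smoothTransition (y - 1)

theorem contDiff_cutId : ContDiff ℝ ∞ cutId :=
  contDiff_id.mul (Real.smoothTransition.contDiff.comp (contDiff_id.sub contDiff_const))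

theorem cutId_of_le_one {y : ℝ} (hy : y ≤ 1) : cutId y = 0 := by
  rw [cutId, Real.smoothTransition.zero_of_nonpos (by linarith), mul_zero]

theorem cutId_of_two_le {y : ℝ} (hy : 2 ≤ y) : cutId y = y := by
  rw [cutId, Real.smoothTransition.one_of_one_le (by linarith), mul_one]

theorem abs_cutId_le (y : ℝ) : |cutId y| ≤ |y| := by
  rw [cutId, abs_mul, abs_of_nonneg (Real.smoothTransition.nonneg _)]
  exact mul_le_of_le_one_right (abs_nonneg _) (Real.smoothTransition.le_one _)

/-- The derivative is 0 left of 1, equals 1 right of 2, and is continuous on the compact interval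
between. -/
theorem exists_abs_deriv_cutId_le : ∃ C : ℝ, ∀ y, |deriv cutId y| ≤ C := by
  obtain ⟨C, hC⟩ := isCompact_Icc.exists_bound_of_continuousOn (s := Set.Icc (1 : ℝ) 2)
    (contDiff_cutId.continuous_deriv (by simp)).continuousOn
  refine ⟨max C 1, fun y => ?_⟩
  rcases lt_or_ge y 1 with h1 | h1
  · have : cutId =ᶠ[𝓝 y] fun _ => 0 := by
      filter_upwards [Iio_mem_nhds h1] with z hz using cutId_of_le_one (le_of_lt hz)
    rw [this.deriv_eq]
    simp
  · rcases le_or_gt y 2 with h2 | h2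
    · exact (hC y ⟨h1, h2⟩).trans (le_max_left _ _)
    · have : cutId =ᶠ[𝓝 y] fun z => z := by
        filter_upwards [Ioi_mem_nhds h2] with z hz using cutId_of_two_le (le_of_lt hz)
      rw [this.deriv_eq]
      simp

/-- Smooth compactly supported approximations of the bubble function. -/
def Elt.cutBub (κ : Elt d) (n : ℕ) (x : E d) : ℝ :=
  ((n : ℝ) + 1)⁻¹ * cutId (((n : ℝ) + 1) * κ.bub x)

theorem Elt.cutBub_eventuallyEq_zero (κ : Elt d) (n : ℕ) {x : E d} (hx : κ.bub x = 0) :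
    κ.cutBub n =ᶠ[𝓝 x] fun _ => 0 := by
  have hc : Continuous fun y => ((n : ℝ) + 1) * κ.bub y := continuous_const.mul κ.continuous_bub
  have : ∀ᶠ y in 𝓝 x, ((n : ℝ) + 1) * κ.bub y < 1 :=
    hc.continuousAt.eventually_lt continuousAt_const (by simp [hx])
  filter_upwards [this] with y hy
  rw [Elt.cutBub, cutId_of_le_one hy.le, mul_zero]

/-- The support lies in the closed set where the bubble is at least `1 / (n + 1)`, inside the
interior of `κ`. There the bubble is locally polynomial, and elsewhere the cut-off vanishes locally,
so smoothness holds everywhere. -/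
theorem Elt.isTest_cutBub (κ : Elt d) (n : ℕ) (hκ : interior κ.carrier ⊆ Ω) :
    IsTest Ω (κ.cutBub n) := by
  have hc : Continuous fun y => ((n : ℝ) + 1) * κ.bub y := continuous_const.mul κ.continuous_bub
  have hsub : tsupport (κ.cutBub n) ⊆ interior κ.carrier := by
    have h1 : tsupport (κ.cutBub n) ⊆ {x | 1 ≤ ((n : ℝ) + 1) * κ.bub x} := by
      refine closure_minimal (fun x hx => ?_) (isClosed_le continuous_const hc)
      by_contra hcon
      refine hx ?_
      rw [Elt.cutBub, cutId_of_le_one (not_le.1 hcon).le, mul_zero]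
    intro x hx
    by_contra hcon
    have := h1 hx
    simp only [Set.mem_ofPred_eq, κ.bub_eq_zero hcon, mul_zero] at this
    linarith
  refine ⟨contDiff_iff_contDiffAt.2 fun x => ?_, ?_, hsub.trans hκ⟩
  · by_cases hx : x ∈ interior κ.carrier
    · have h : κ.cutBub n =ᶠ[𝓝 x]
          fun y => ((n : ℝ) + 1)⁻¹ * cutId (((n : ℝ) + 1) * κ.bubble y) := by
        filter_upwards [κ.bub_eventuallyEq hx] with y hy
        rw [Elt.cutBub, hy]
      refine ContDiffAt.congr_of_eventuallyEq ?_ h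
      exact (contDiff_const.mul (contDiff_cutId.comp
        (contDiff_const.mul κ.contDiff_bubble))).contDiffAt
    · exact contDiffAt_const.congr_of_eventuallyEq
        (κ.cutBub_eventuallyEq_zero n (κ.bub_eq_zero hx))
  · exact κ.isCompact_carrier.of_isClosed_subset (isClosed_tsupport _)
      (hsub.trans interior_subset)

/-- Equality of germs, not just of values, is needed so that gradients agree as well. -/
theorem Elt.eventually_cutBub_eventuallyEq (κ : Elt d) {x : E d}
    (hx : x ∈ interior κ.carrier ∨ x ∉ κ.carrier) :
    ∀ᶠ n in atTop, κ.cutBub n =ᶠ[𝓝 x] κ.bub := by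
  rcases hx with hx | hx
  · have hpos := κ.bub_pos hx
    have hB : ∀ᶠ y in 𝓝 x, κ.bub x / 2 < κ.bub y :=
      continuousAt_const.eventually_lt κ.continuous_bub.continuousAt (half_lt_self hpos)
    -- Near `x` the bubble exceeds half its value at `x`; the 4 then brings `(n + 1) * κ.bub y`
    -- above 2, where `cutId` is the identity.
    obtain ⟨N, hN⟩ := exists_nat_gt (4 / κ.bub x)
    filter_upwards [eventually_ge_atTop N] with n hn
    filter_upwards [hB] with y hy
    have hn' : (N : ℝ) ≤ n := Nat.cast_le.2 hn
    have h4 : 4 < (n : ℝ) * κ.bub x := by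
      rw [div_lt_iff₀ hpos] at hN
      nlinarith
    have h0 : (0 : ℝ) ≤ n := Nat.cast_nonneg n
    have : 2 ≤ ((n : ℝ) + 1) * κ.bub y := by nlinarith
    rw [Elt.cutBub, cutId_of_two_le this]
    field_simp
  · refine Eventually.of_forall fun n => ?_
    have h0 : κ.bub =ᶠ[𝓝 x] fun _ => 0 := by
      filter_upwards [κ.isClosed_carrier.isOpen_compl.mem_nhds hx] with y hy
        using κ.bub_of_notMem hy
    exact (κ.cutBub_eventuallyEq_zero n (κ.bub_of_notMem hx)).trans h0.symm

theorem tendsto_eLpNorm_zero_of_bounded {μ : Measure (E d)} [IsFiniteMeasure μ]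
    {f : ℕ → E d → ℝ} (hf : ∀ n, AEStronglyMeasurable (f n) μ) {C : ℝ}
    (hC : ∀ n, ∀ᵐ x ∂μ, |f n x| ≤ C) (hlim : ∀ᵐ x ∂μ, ∀ᶠ n in atTop, f n x = 0) :
    Tendsto (fun n => eLpNorm (f n) 2 μ) atTop (𝓝 0) := by
  have h : Tendsto (fun n => ∫⁻ x, ‖f n x‖ₑ ^ (2 : ℝ) ∂μ) atTop (𝓝 (∫⁻ _, 0 ∂μ)) := by
    refine tendsto_lintegral_of_dominated_convergence' (fun _ => (‖C‖ₑ) ^ (2 : ℝ))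
      (fun n => (hf n).enorm.pow_const _) (fun n => ?_) ?_ ?_
    · filter_upwards [hC n] with x hx
      refine ENNReal.rpow_le_rpow ?_ (by norm_num)
      rw [enorm_le_iff_norm_le]
      exact hx.trans (le_abs_self C)
    · rw [lintegral_const]
      exact ENNReal.mul_ne_top (ENNReal.rpow_ne_top_of_nonneg (by norm_num) enorm_ne_top)
        (measure_ne_top _ _)
    · filter_upwards [hlim] with x hx
      refine tendsto_const_nhds.congr' ?_
      filter_upwards [hx] with n hn
      simp [hn]
  rw [lintegral_zero] at h
  have h2 := h.ennrpow_const (1 / 2)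
  rw [ENNReal.zero_rpow_of_pos (by norm_num)] at h2
  refine h2.congr fun n => ?_
  rw [eLpNorm_eq_lintegral_rpow_enorm_toReal (by norm_num) (by norm_num)]
  simp

/-- Almost everywhere the cut-offs and their gradients eventually equal those of the bubble, and
both are bounded uniformly in `n`: the factors `n + 1` and its inverse cancel in the chain rule.
Dominated convergence gives convergence in H¹. -/
theorem Triangulation.memH10_bub (T : Triangulation Ω) (hΩ : IsOpen Ω)
    (hΩr : interior (closure Ω) = Ω) {κ : Elt d} (hκ : κ ∈ T.elts) : MemH10 Ω κ.bub := by
  have := T.isFiniteMeasure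
  have hreg := T.lipReg_bub hΩ hκ
  have htest := fun n => κ.isTest_cutBub n (T.interior_subset hΩr hκ)
  have hae : ∀ᵐ x ∂(volume.restrict Ω), ∀ᶠ n in atTop, κ.cutBub n =ᶠ[𝓝 x] κ.bub := by
    filter_upwards [ae_restrict_of_ae κ.ae_mem_interior_or_notMem] with x hx
      using κ.eventually_cutBub_eventuallyEq hx
  refine ⟨hreg.memH1 hΩ, κ.cutBub, htest, ?_, fun i => ?_⟩
  · obtain ⟨M, hM⟩ := hreg.bdd
    refine tendsto_eLpNorm_zero_of_bounded (C := M + M)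
      (fun n => (κ.continuous_bub.sub (htest n).1.continuous).aestronglyMeasurable)
      (fun n => ?_) ?_
    · refine ae_restrict_of_forall_mem hΩ.measurableSet fun x hx => ?_
      refine (abs_sub _ _).trans (add_le_add (hM x hx) (le_trans ?_ (hM x hx)))
      have hn : (0 : ℝ) < (n : ℝ) + 1 := by positivity
      rw [Elt.cutBub, abs_mul, abs_of_pos (inv_pos.2 hn), inv_mul_le_iff₀ hn]
      refine (abs_cutId_le _).trans ?_
      rw [abs_mul, abs_of_pos hn]
    · filter_upwards [hae] with x hx
      filter_upwards [hx] with n hn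
      rw [hn.self_of_nhds, sub_self]
  · obtain ⟨K, hK⟩ := hreg.exists_abs_classicalPartial_le hΩ i
    obtain ⟨C, hC⟩ := exists_abs_deriv_cutId_le
    refine tendsto_eLpNorm_zero_of_bounded (C := K + C * K)
      (fun n => ((hreg.memH1 hΩ).memLp_weakPartial hΩ i).1.sub
        (measurable_classicalPartial i _).aestronglyMeasurable) (fun n => ?_) ?_
    · filter_upwards [hreg.weakPartial_ae_eq hΩ i, hreg.diff, ae_restrict_mem hΩ.measurableSet]
        with x hx hdiff hxΩ
      have hn : (n : ℝ) + 1 ≠ 0 := by positivity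
      have hder : classicalPartial i (κ.cutBub n) x
          = deriv cutId (((n : ℝ) + 1) * κ.bub x) * classicalPartial i κ.bub x := by
        have h1 : HasDerivAt cutId (deriv cutId (((n : ℝ) + 1) * κ.bub x))
            (((n : ℝ) + 1) * κ.bub x) :=
          ((contDiff_cutId.differentiable (by simp)) _).hasDerivAt
        have h2 := (h1.comp_hasFDerivAt x (hdiff.hasFDerivAt.const_mul ((n : ℝ) + 1))).const_mul
          (((n : ℝ) + 1)⁻¹)
        have h3 : HasFDerivAt (κ.cutBub n) (((n : ℝ) + 1)⁻¹ •
          deriv cutId (((n : ℝ) + 1) * κ.bub x) • ((n : ℝ) + 1) • fderiv ℝ κ.bub x) x := h2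
        rw [classicalPartial, h3.fderiv]
        simp only [_root_.smul_apply, smul_eq_mul, classicalPartial]
        field_simp
      rw [hx, hder]
      refine (abs_sub _ _).trans (add_le_add (hK x hxΩ) ?_)
      rw [abs_mul]
      exact mul_le_mul (hC _) (hK x hxΩ) (abs_nonneg _) ((abs_nonneg _).trans (hC 0))
    · filter_upwards [hae, hreg.weakPartial_ae_eq hΩ i] with x hx hx2
      filter_upwards [hx] with n hn
      rw [hx2, classicalPartial, classicalPartial, hn.fderiv_eq, sub_self]

/-! ### Coefficients -/

/-- The mean value inequality bounds `α` on the open interval from a reference point `s`. Nothing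
ties the endpoint values to the interior ones, so they enter the bound separately. -/
theorem AdmissibleCoeff.exists_abs_le {ε₀ : ℝ} {α : ℝ → ℝ} (h : AdmissibleCoeff ε₀ α) :
    ∃ M, ∀ t ∈ Set.Icc ε₀ 1, |α t| ≤ M := by
  obtain ⟨K, hK⟩ := h.deriv_bdd
  rcases (Set.Ioo ε₀ 1).eq_empty_or_nonempty with he | ⟨s, hs⟩
  · refine ⟨|α ε₀|, fun t ht => ?_⟩
    rw [Set.Ioo_eq_empty_iff, not_lt] at he
    rw [le_antisymm (ht.2.trans he) ht.1]
  · refine ⟨|α ε₀| + |α 1| + (|α s| + |K| * |1 - ε₀|), fun t ht => ?_⟩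
    have hK0 : 0 ≤ |K| * |1 - ε₀| := by positivity
    rcases eq_or_lt_of_le ht.1 with h0 | h0
    · rw [← h0]
      linarith [abs_nonneg (α 1), abs_nonneg (α s)]
    rcases eq_or_lt_of_le ht.2 with h1 | h1
    · rw [h1]
      linarith [abs_nonneg (α ε₀), abs_nonneg (α s)]
    have hlip := (convex_Ioo ε₀ 1).norm_image_sub_le_of_norm_deriv_le (f := α) (C := |K|)
      (fun x hx => h.diff x hx) (fun x hx => by
        rw [Real.norm_eq_abs, abs_of_pos (h.deriv_pos x hx)]
        exact (hK x hx).trans (le_abs_self K)) hs ⟨h0, h1⟩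
    rw [Real.norm_eq_abs, Real.norm_eq_abs] at hlip
    have h2 : |t - s| ≤ |1 - ε₀| := by
      rw [abs_of_pos (by linarith [hs.1, hs.2] : 0 < 1 - ε₀)]
      exact abs_le.2 ⟨by linarith [hs.1, hs.2], by linarith [hs.1, hs.2]⟩
    have h3 : |K| * |t - s| ≤ |K| * |1 - ε₀| := by gcongr
    have h4 := abs_add_le (α t - α s) (α s)
    rw [sub_add_cancel] at h4
    linarith [abs_nonneg (α ε₀), abs_nonneg (α 1)]

/-- `α` is continuous on the open interval but arbitrary outside the closed one, so it is truncated;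
changing two endpoint values does not affect measurability. -/
theorem AdmissibleCoeff.measurable_indicator {ε₀ : ℝ} {α : ℝ → ℝ} (h : AdmissibleCoeff ε₀ α) :
    Measurable ((Set.Icc ε₀ 1).indicator α) := by
  classical
  have hc : ContinuousOn α (Set.Ioo ε₀ 1) := fun t ht =>
    (h.diff t ht).continuousAt.continuousWithinAt
  have hm : Measurable ((Set.Ioo ε₀ 1).piecewise α 0) :=
    hc.measurable_piecewise continuousOn_const measurableSet_Ioo
  have e : (Set.Icc ε₀ 1).indicator α = ({ε₀} : Set ℝ).piecewise
      (fun _ => (Set.Icc ε₀ 1).indicator α ε₀) (({1} : Set ℝ).piecewise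
        (fun _ => (Set.Icc ε₀ 1).indicator α 1) ((Set.Ioo ε₀ 1).piecewise α 0)) := by
    funext t
    by_cases h0 : t = ε₀
    · simp [h0]
    by_cases h1 : t = 1
    · subst h1
      simp [Set.piecewise, h0]
    have : t ∈ Set.Icc ε₀ 1 ↔ t ∈ Set.Ioo ε₀ 1 :=
      ⟨fun h => ⟨lt_of_le_of_ne h.1 (Ne.symm h0), lt_of_le_of_ne h.2 h1⟩, fun h => ⟨h.1.le, h.2.le⟩⟩
    simp only [Set.piecewise, Set.mem_singleton_iff, h0, h1, if_false, Set.indicator, this,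
      Pi.zero_apply]
  rw [e]
  exact measurable_const.piecewise (measurableSet_singleton ε₀)
    (measurable_const.piecewise (measurableSet_singleton (1 : ℝ)) hm)

theorem AdmissibleCoeff.memLp_top (hΩ : IsOpen Ω) {ε₀ : ℝ} {α : ℝ → ℝ}
    (h : AdmissibleCoeff ε₀ α) {ε : E d → ℝ} (hε : LipReg Ω ε)
    (hbd : ∀ x ∈ Ω, ε x ∈ Set.Icc ε₀ 1) :
    MemLp (fun x => α (ε x)) ⊤ (volume.restrict Ω) := by
  obtain ⟨M, hM⟩ := h.exists_abs_le
  refine memLp_top_of_bound ?_ M (ae_restrict_of_forall_mem hΩ.measurableSet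
    fun x hx => hM _ (hbd x hx))
  have h1 : AEMeasurable (fun x => (Set.Icc ε₀ 1).indicator α (ε x)) (volume.restrict Ω) :=
    h.measurable_indicator.comp_aemeasurable (hε.aestronglyMeasurable hΩ).aemeasurable
  refine (h1.congr ?_).aestronglyMeasurable
  exact ae_restrict_of_forall_mem hΩ.measurableSet fun x hx =>
    Set.indicator_of_mem (hbd x hx) α

/-! ### Vector fields -/

theorem inner_eq_sum (x y : E d) : inner ℝ x y = ∑ j, x j * y j := by
  rw [PiLp.inner_apply]
  refine Finset.sum_congr rfl fun j _ => ?_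
  rw [real_inner_comm]
  rfl

theorem MemH1Vec.linear_comb (hΩ : IsOpen Ω) {u v : E d → E d} (hu : MemH1Vec Ω u)
    (hv : MemH1Vec Ω v) (s t : ℝ) : MemH1Vec Ω (fun x => s • u x + t • v x) :=
  fun j => (hu j).linear_comb hΩ (hv j) s t

theorem MemH1Vec.weakPartial_linear_comb (hΩ : IsOpen Ω) {u v : E d → E d} (hu : MemH1Vec Ω u)
    (hv : MemH1Vec Ω v) (s t : ℝ) :
    ∀ᵐ x ∂(volume.restrict Ω), ∀ i j, weakPartial Ω i (fun y => (s • u y + t • v y) j) x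
      = s * weakPartial Ω i (fun y => u y j) x + t * weakPartial Ω i (fun y => v y j) x :=
  ae_all_iff.2 fun i => ae_all_iff.2 fun j => (hu j).weakPartial_linear_comb hΩ (hv j) s t i

theorem MemH1Vec.smul_lipReg (hΩ : IsOpen Ω) {ε : E d → ℝ} (hε : LipReg Ω ε) {u : E d → E d}
    (hu : MemH1Vec Ω u) : MemH1Vec Ω (fun y => ε y • u y) :=
  fun j => (hu j).mul_lipReg hΩ hε

theorem MemH1Vec.memLp_weakDiv (hΩ : IsOpen Ω) {u : E d → E d} (hu : MemH1Vec Ω u) :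
    MemLp (weakDiv Ω u) 2 (volume.restrict Ω) :=
  memLp_finsetSum _ fun i _ => (hu i).memLp_weakPartial hΩ i

theorem MemH1Vec.weakDiv_smul_linear_comb (hΩ : IsOpen Ω) {ε : E d → ℝ} (hε : LipReg Ω ε)
    {u v : E d → E d} (hu : MemH1Vec Ω u) (hv : MemH1Vec Ω v) (s t : ℝ) :
    weakDiv Ω (fun y => ε y • (s • u y + t • v y)) =ᵐ[volume.restrict Ω]
      fun x => s * weakDiv Ω (fun y => ε y • u y) x + t * weakDiv Ω (fun y => ε y • v y) x := by
  have e : (fun y => ε y • (s • u y + t • v y))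
      = fun y => s • (ε y • u y) + t • (ε y • v y) := by
    funext y
    rw [smul_add, smul_comm (ε y) s, smul_comm (ε y) t]
  rw [e]
  filter_upwards [(hu.smul_lipReg hΩ hε).weakPartial_linear_comb hΩ (hv.smul_lipReg hΩ hε) s t]
    with x hx
  simp only [weakDiv, hx, Finset.sum_add_distrib, Finset.mul_sum]

theorem MemH1Vec.memLp_norm {u : E d → E d} (hu : MemH1Vec Ω u) :
    MemLp (fun x => ‖u x‖) 2 (volume.restrict Ω) := by
  have : MemLp u 2 (volume.restrict Ω) := MemLp.of_eval_piLp fun j => (hu j).1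
  exact this.norm

/-! ### Linearity of the forms -/

/-- The pointwise identity is asked only almost everywhere because weak derivatives are linear only
in that sense. -/
theorem integral_linear_comb {μ : Measure (E d)} {F F₁ F₂ : E d → ℝ} (h₁ : Integrable F₁ μ)
    (h₂ : Integrable F₂ μ) {s t : ℝ} (h : ∀ᵐ x ∂μ, F x = s * F₁ x + t * F₂ x) :
    ∫ x, F x ∂μ = s * ∫ x, F₁ x ∂μ + t * ∫ x, F₂ x ∂μ := by
  rw [integral_congr_ae h, integral_add (h₁.const_mul s) (h₂.const_mul t), integral_const_mul,
    integral_const_mul]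

theorem linear_comb_two {s t A A₁ A₂ B B₁ B₂ : ℝ} (c : ℝ) (hA : A = s * A₁ + t * A₂)
    (hB : B = s * B₁ + t * B₂) : c * A + B = s * (c * A₁ + B₁) + t * (c * A₂ + B₂) := by
  rw [hA, hB]
  ring

theorem linear_comb_three {s t A A₁ A₂ B B₁ B₂ C C₁ C₂ : ℝ} (c : ℝ) (hA : A = s * A₁ + t * A₂)
    (hB : B = s * B₁ + t * B₂) (hC : C = s * C₁ + t * C₂) :
    A + c * B + C = s * (A₁ + c * B₁ + C₁) + t * (A₂ + c * B₂ + C₂) := by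
  rw [hA, hB, hC]
  ring

theorem integrable_top_mul {μ : Measure (E d)} {m g : E d → ℝ} (hm : MemLp m ⊤ μ)
    (hg : Integrable g μ) : Integrable (fun x => m x * g x) μ :=
  memLp_one_iff_integrable.1 (MemLp.mul (memLp_one_iff_integrable.2 hg) hm)

theorem integrable_two_mul {μ : Measure (E d)} {f g : E d → ℝ} (hf : MemLp f 2 μ)
    (hg : MemLp g 2 μ) : Integrable (fun x => f x * g x) μ :=
  hf.integrable_mul hg

theorem MemH1Vec.integrable_grad (hΩ : IsOpen Ω) {u v : E d → E d} (hu : MemH1Vec Ω u)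
    (hv : MemH1Vec Ω v) {m : E d → ℝ} (hm : MemLp m ⊤ (volume.restrict Ω)) :
    Integrable (fun x => m x * ∑ i : Fin d, ∑ j : Fin d,
      weakPartial Ω i (fun y => u y j) x * weakPartial Ω i (fun y => v y j) x)
      (volume.restrict Ω) :=
  integrable_top_mul hm (integrable_finsetSum _ fun i _ => integrable_finsetSum _ fun j _ =>
    integrable_two_mul ((hu j).memLp_weakPartial hΩ i) ((hv j).memLp_weakPartial hΩ i))

theorem integrable_inner {μ : Measure (E d)} {u v : E d → E d}
    (hu : ∀ j, MemLp (fun x => u x j) 2 μ) (hv : ∀ j, MemLp (fun x => v x j) 2 μ) :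
    Integrable (fun x => inner ℝ (u x) (v x)) μ := by
  simp_rw [inner_eq_sum]
  exact integrable_finsetSum _ fun j _ => integrable_two_mul (hu j) (hv j)

theorem memLp_inner {μ : Measure (E d)} {u v : E d → E d}
    (hu : ∀ j, MemLp (fun x => u x j) 2 μ) (hv : ∀ j, MemLp (fun x => v x j) ⊤ μ) :
    MemLp (fun x => inner ℝ (u x) (v x)) 2 μ := by
  simp_rw [inner_eq_sum]
  exact memLp_finsetSum _ fun j _ => MemLp.mul (hv j) (hu j)

theorem inner_linear_comb_right (s t : ℝ) (x y z : E d) :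
    inner ℝ x (s • y + t • z) = s * inner ℝ x y + t * inner ℝ x z := by
  rw [inner_add_right, real_inner_smul_right, real_inner_smul_right]

theorem inner_linear_comb_left (s t : ℝ) (x y z : E d) :
    inner ℝ (s • y + t • z) x = s * inner ℝ y x + t * inner ℝ z x := by
  rw [inner_add_left, real_inner_smul_left, real_inner_smul_left]

theorem aForm_comm (Re : ℝ) (α : ℝ → ℝ) (ε : E d → ℝ) (u v : E d → E d) :
    aForm Ω Re α ε u v = aForm Ω Re α ε v u := by
  simp only [aForm, mul_comm (weakPartial Ω _ (fun y => u y _) _), real_inner_comm]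

theorem aForm_linear_right (hΩ : IsOpen Ω) (Re : ℝ) {α : ℝ → ℝ} {ε : E d → ℝ}
    (hε : LipReg Ω ε) (hα : MemLp (fun x => α (ε x)) ⊤ (volume.restrict Ω)) {u v w : E d → E d}
    (hu : MemH1Vec Ω u) (hv : MemH1Vec Ω v) (hw : MemH1Vec Ω w) (s t : ℝ) :
    aForm Ω Re α ε u (fun x => s • v x + t • w x)
      = s * aForm Ω Re α ε u v + t * aForm Ω Re α ε u w := by
  unfold aForm
  refine linear_comb_two _
    (integral_linear_comb (hu.integrable_grad hΩ hv (hε.memLp_top hΩ))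
      (hu.integrable_grad hΩ hw (hε.memLp_top hΩ)) ?_)
    (integral_linear_comb
      (integrable_top_mul hα (integrable_inner (fun j => (hu j).1) fun j => (hv j).1))
      (integrable_top_mul hα (integrable_inner (fun j => (hu j).1) fun j => (hw j).1)) ?_)
  · filter_upwards [hv.weakPartial_linear_comb hΩ hw s t] with x hx
    simp only [hx, mul_add, Finset.sum_add_distrib, Finset.mul_sum]
    congr 1 <;>
    exact Finset.sum_congr rfl fun i _ => Finset.sum_congr rfl fun j _ => by ring
  · refine Eventually.of_forall fun x => ?_
    rw [inner_linear_comb_right]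
    ring

theorem aForm_linear_left (hΩ : IsOpen Ω) (Re : ℝ) {α : ℝ → ℝ} {ε : E d → ℝ}
    (hε : LipReg Ω ε) (hα : MemLp (fun x => α (ε x)) ⊤ (volume.restrict Ω)) {u v w : E d → E d}
    (hu : MemH1Vec Ω u) (hv : MemH1Vec Ω v) (hw : MemH1Vec Ω w) (s t : ℝ) :
    aForm Ω Re α ε (fun x => s • v x + t • w x) u
      = s * aForm Ω Re α ε v u + t * aForm Ω Re α ε w u := by
  rw [aForm_comm, aForm_linear_right hΩ Re hε hα hu hv hw, aForm_comm Re α ε u v,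
    aForm_comm Re α ε u w]

theorem bForm_linear_left (hΩ : IsOpen Ω) {ε : E d → ℝ} (hε : LipReg Ω ε) {q : E d → ℝ}
    (hq : MemLp q 2 (volume.restrict Ω)) {v w : E d → E d} (hv : MemH1Vec Ω v)
    (hw : MemH1Vec Ω w) (s t : ℝ) :
    bForm Ω ε (fun x => s • v x + t • w x) q = s * bForm Ω ε v q + t * bForm Ω ε w q := by
  unfold bForm
  refine integral_linear_comb
    (integrable_two_mul ((hv.smul_lipReg hΩ hε).memLp_weakDiv hΩ) hq)
    (integrable_two_mul ((hw.smul_lipReg hΩ hε).memLp_weakDiv hΩ) hq) ?_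
  filter_upwards [hv.weakDiv_smul_linear_comb hΩ hε hw s t] with x hx
  rw [hx]
  ring

theorem bForm_linear_right (hΩ : IsOpen Ω) {ε : E d → ℝ} (hε : LipReg Ω ε) {p q : E d → ℝ}
    (hp : MemLp p 2 (volume.restrict Ω)) (hq : MemLp q 2 (volume.restrict Ω)) {v : E d → E d}
    (hv : MemH1Vec Ω v) (s t : ℝ) :
    bForm Ω ε v (fun x => s * p x + t * q x) = s * bForm Ω ε v p + t * bForm Ω ε v q := by
  unfold bForm
  refine integral_linear_comb
    (integrable_two_mul ((hv.smul_lipReg hΩ hε).memLp_weakDiv hΩ) hp)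
    (integrable_two_mul ((hv.smul_lipReg hΩ hε).memLp_weakDiv hΩ) hq)
    (Eventually.of_forall fun x => by ring)

theorem lForm_linear (hΩ : IsOpen Ω) {ε : E d → ℝ} (hε : LipReg Ω ε) {f : E d → E d}
    (hf : MemLp f 2 (volume.restrict Ω)) {v w : E d → E d} (hv : MemH1Vec Ω v)
    (hw : MemH1Vec Ω w) (s t : ℝ) :
    lForm Ω ε f (fun x => s • v x + t • w x) = s * lForm Ω ε f v + t * lForm Ω ε f w := by
  have hεf : ∀ j, MemLp (fun x => (ε x • f x) j) 2 (volume.restrict Ω) := fun j =>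
    memLp_top_mul (hε.memLp_top hΩ) (hf.eval_piLp j)
  unfold lForm
  exact integral_linear_comb (integrable_inner hεf fun j => (hv j).1)
    (integrable_inner hεf fun j => (hw j).1)
    (Eventually.of_forall fun x => inner_linear_comb_right s t _ _ _)

/-- Two L² factors, `u` and the gradient of `v`, times the bounded factors `ε` and `w`: boundedness
of the discrete argument `w` replaces a Sobolev embedding. -/
theorem MemH1Vec.integrable_convection (hΩ : IsOpen Ω) {ε : E d → ℝ} (hε : LipReg Ω ε)
    {u v w : E d → E d} (hu : MemH1Vec Ω u) (hv : MemH1Vec Ω v)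
    (hw : ∀ j, LipReg Ω fun x => w x j) :
    Integrable (fun x => ε x * ∑ j : Fin d,
      (∑ i : Fin d, u x i * weakPartial Ω i (fun y => v y j) x) * w x j) (volume.restrict Ω) := by
  refine integrable_top_mul (hε.memLp_top hΩ) (integrable_finsetSum _ fun j _ => ?_)
  simp_rw [mul_comm _ (w _ j)]
  exact integrable_top_mul ((hw j).memLp_top hΩ) (integrable_finsetSum _ fun i _ =>
    integrable_two_mul (hu i).1 ((hv j).memLp_weakPartial hΩ i))

theorem MemH1Vec.integrable_div_mul (hΩ : IsOpen Ω) {ε : E d → ℝ} (hε : LipReg Ω ε)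
    {u v w : E d → E d} (hu : MemH1Vec Ω u) (hv : MemH1Vec Ω v)
    (hw : ∀ j, LipReg Ω fun x => w x j) :
    Integrable (fun x => weakDiv Ω (fun y => ε y • u y) x * inner ℝ (v x) (w x))
      (volume.restrict Ω) :=
  integrable_two_mul ((hu.smul_lipReg hΩ hε).memLp_weakDiv hΩ)
    (memLp_inner (fun j => (hv j).1) fun j => (hw j).memLp_top hΩ)

theorem MemH1Vec.integrable_norm_mul (hΩ : IsOpen Ω) {m : E d → ℝ}
    (hm : MemLp m ⊤ (volume.restrict Ω)) {u v w : E d → E d} (hu : MemH1Vec Ω u)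
    (hv : MemH1Vec Ω v) (hw : ∀ j, LipReg Ω fun x => w x j) :
    Integrable (fun x => m x * ‖u x‖ * inner ℝ (v x) (w x)) (volume.restrict Ω) :=
  integrable_two_mul (memLp_top_mul hm hu.memLp_norm)
    (memLp_inner (fun j => (hv j).1) fun j => (hw j).memLp_top hΩ)

theorem cForm_linear_middle (hΩ : IsOpen Ω) {β : ℝ → ℝ} {ε : E d → ℝ} (hε : LipReg Ω ε)
    (hβ : MemLp (fun x => β (ε x)) ⊤ (volume.restrict Ω)) {u v v' w : E d → E d}
    (hu : MemH1Vec Ω u) (hv : MemH1Vec Ω v) (hv' : MemH1Vec Ω v')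
    (hw : ∀ j, LipReg Ω fun x => w x j) (s t : ℝ) :
    cForm Ω β ε u (fun x => s • v x + t • v' x) w
      = s * cForm Ω β ε u v w + t * cForm Ω β ε u v' w := by
  unfold cForm
  refine linear_comb_three _
    (integral_linear_comb (hu.integrable_convection hΩ hε hv hw)
      (hu.integrable_convection hΩ hε hv' hw) ?_)
    (integral_linear_comb (hu.integrable_div_mul hΩ hε hv hw)
      (hu.integrable_div_mul hΩ hε hv' hw) ?_)
    (integral_linear_comb (hu.integrable_norm_mul hΩ hβ hv hw)
      (hu.integrable_norm_mul hΩ hβ hv' hw) ?_)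
  · filter_upwards [hv.weakPartial_linear_comb hΩ hv' s t] with x hx
    simp only [hx, mul_add, add_mul, Finset.sum_add_distrib, Finset.mul_sum, Finset.sum_mul]
    congr 1 <;>
    exact Finset.sum_congr rfl fun i _ => Finset.sum_congr rfl fun j _ => by ring
  · refine Eventually.of_forall fun x => ?_
    rw [inner_linear_comb_left]
    ring
  · refine Eventually.of_forall fun x => ?_
    rw [inner_linear_comb_left]
    ring

theorem cForm_linear_right (hΩ : IsOpen Ω) {β : ℝ → ℝ} {ε : E d → ℝ} (hε : LipReg Ω ε)
    (hβ : MemLp (fun x => β (ε x)) ⊤ (volume.restrict Ω)) {u v w w' : E d → E d}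
    (hu : MemH1Vec Ω u) (hv : MemH1Vec Ω v) (hw : ∀ j, LipReg Ω fun x => w x j)
    (hw' : ∀ j, LipReg Ω fun x => w' x j) (s t : ℝ) :
    cForm Ω β ε u v (fun x => s • w x + t • w' x)
      = s * cForm Ω β ε u v w + t * cForm Ω β ε u v w' := by
  unfold cForm
  refine linear_comb_three _
    (integral_linear_comb (hu.integrable_convection hΩ hε hv hw)
      (hu.integrable_convection hΩ hε hv hw') ?_)
    (integral_linear_comb (hu.integrable_div_mul hΩ hε hv hw)
      (hu.integrable_div_mul hΩ hε hv hw') ?_)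
    (integral_linear_comb (hu.integrable_norm_mul hΩ hβ hv hw)
      (hu.integrable_norm_mul hΩ hβ hv hw') ?_)
  · refine Eventually.of_forall fun x => ?_
    simp only [PiLp.add_apply, PiLp.smul_apply, smul_eq_mul, mul_add, Finset.sum_add_distrib,
      Finset.mul_sum, Finset.sum_mul]
    congr 1 <;>
    exact Finset.sum_congr rfl fun i _ => Finset.sum_congr rfl fun j _ => by ring
  · refine Eventually.of_forall fun x => ?_
    rw [inner_linear_comb_right]
    ring
  · refine Eventually.of_forall fun x => ?_
    rw [inner_linear_comb_right]
    ring

/-! ### Energy identity and pressure -/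

/-- Twice the convection term plus the divergence term is the sum over `i`, `j` of the vanishing
integrals of `MemH1.integral_convection`, taken with the components of `ε u` and `v`. No condition
on the divergence of `ε u` is needed. -/
theorem cForm_self (hΩ : IsOpen Ω) {β : ℝ → ℝ} {ε : E d → ℝ} (hε : LipReg Ω ε)
    {u v : E d → E d} (hu : MemH1Vec Ω u) (hv : ∀ j, LipReg Ω fun x => v x j)
    (hv0 : MemH10Vec Ω v) :
    cForm Ω β ε u v v = ∫ x in Ω, β (ε x) * ‖u x‖ * inner ℝ (v x) (v x) := by
  have hv1 : MemH1Vec Ω v := fun j => (hv0 j).1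
  have hU := hu.smul_lipReg hΩ hε
  have hint : ∀ i j, Integrable (fun x => weakPartial Ω i (fun y => (ε y • u y) i) x
      * (v x j * v x j) + 2 * ((ε x • u x) i * weakPartial Ω i (fun y => v y j) x * v x j))
      (volume.restrict Ω) := by
    intro i j
    refine (integrable_two_mul ((hU i).memLp_weakPartial hΩ i)
      (memLp_top_mul ((hv j).memLp_top hΩ) (hv1 j).1)).add (Integrable.const_mul ?_ 2)
    simp_rw [mul_comm _ (v _ j)]
    exact integrable_top_mul ((hv j).memLp_top hΩ)
      (integrable_two_mul (hU i).1 ((hv1 j).memLp_weakPartial hΩ i))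
  have hzero : ∫ x in Ω, ∑ i, ∑ j, (weakPartial Ω i (fun y => (ε y • u y) i) x
      * (v x j * v x j) + 2 * ((ε x • u x) i * weakPartial Ω i (fun y => v y j) x * v x j))
      = 0 := by
    rw [integral_finsetSum _ fun i _ => integrable_finsetSum _ fun j _ => hint i j]
    refine Finset.sum_eq_zero fun i _ => ?_
    rw [integral_finsetSum _ fun j _ => hint i j]
    exact Finset.sum_eq_zero fun j _ => (hU i).integral_convection hΩ (hv j) (hv0 j) i
  have hlin := integral_linear_comb (s := 2) (t := 1) (hu.integrable_convection hΩ hε hv1 hv)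
    (hu.integrable_div_mul hΩ hε hv1 hv) (F := fun x => ∑ i, ∑ j,
      (weakPartial Ω i (fun y => (ε y • u y) i) x * (v x j * v x j)
        + 2 * ((ε x • u x) i * weakPartial Ω i (fun y => v y j) x * v x j)))
    (Eventually.of_forall fun x => by
      simp only [inner_eq_sum, weakDiv, PiLp.smul_apply, smul_eq_mul, Finset.sum_add_distrib,
        Finset.mul_sum, Finset.sum_mul]
      rw [add_comm]
      congr 1
      · rw [Finset.sum_comm]
        exact Finset.sum_congr rfl fun i _ => Finset.sum_congr rfl fun j _ => by ring
      · rw [Finset.sum_comm]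
        exact Finset.sum_congr rfl fun i _ => Finset.sum_congr rfl fun j _ => by ring)
  rw [hzero] at hlin
  unfold cForm
  linarith

/-- Integration by parts of the pressure term against a scalar multiple of a basis vector. -/
theorem bForm_single (hΩ : IsOpen Ω) [IsFiniteMeasure (volume.restrict Ω)] {ε B p : E d → ℝ}
    (hε : LipReg Ω ε) (hB0 : MemH10 Ω B) (hp : LipReg Ω p) (j : Fin d) :
    bForm Ω ε (fun x => EuclideanSpace.single j (B x)) p
      = - ∫ x in Ω, ε x * weakPartial Ω j p x * B x := by
  have hdiv : weakDiv Ω (fun y => ε y • EuclideanSpace.single j (B y)) =ᵐ[volume.restrict Ω]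
      fun x => weakPartial Ω j (fun y => ε y * B y) x := by
    have hz : ∀ᵐ x ∂(volume.restrict Ω), ∀ i, weakPartial Ω i (fun _ => 0) x = 0 :=
      ae_all_iff.2 fun i => (hasWeakPartial_zero i).weakPartial_ae_eq hΩ
    filter_upwards [hz] with x hx
    rw [weakDiv, Finset.sum_eq_single j]
    · simp
    · intro i _ hij
      simp only [PiLp.smul_apply, PiLp.single_apply, hij, if_false, smul_zero]
      exact hx i
    · simp
  have hε1 := hε.memH1 hΩ
  have hp1 := hp.memH1 hΩ
  -- Integrate `p ε` against `B`, which carries the boundary condition. The product rules then give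
  -- ∂ⱼ(εB) p + ε ∂ⱼp B = ∂ⱼ(pε) B + pε ∂ⱼB almost everywhere.
  have h := (hε1.mul_lipReg hΩ hp).integral_weakPartial_mul hΩ hB0 j
  have i1 : Integrable (fun x => weakPartial Ω j (fun x => p x * ε x) x * B x)
      (volume.restrict Ω) :=
    integrable_two_mul ((hε1.mul_lipReg hΩ hp).memLp_weakPartial hΩ j) hB0.1.1
  have i2 : Integrable (fun x => p x * ε x * weakPartial Ω j B x) (volume.restrict Ω) :=
    integrable_two_mul (hε1.mul_lipReg hΩ hp).1 (hB0.1.memLp_weakPartial hΩ j)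
  have i3 : Integrable (fun x => weakDiv Ω (fun y => ε y • EuclideanSpace.single j (B y)) x * p x)
      (volume.restrict Ω) := by
    refine Integrable.congr (integrable_two_mul
      ((hB0.1.mul_lipReg hΩ hε).memLp_weakPartial hΩ j) hp1.1) ?_
    filter_upwards [hdiv] with x hx
    rw [hx]
  have i4 : Integrable (fun x => ε x * weakPartial Ω j p x * B x) (volume.restrict Ω) :=
    integrable_two_mul (memLp_top_mul (hε.memLp_top hΩ) (hp1.memLp_weakPartial hΩ j)) hB0.1.1
  rw [bForm, eq_neg_iff_add_eq_zero, ← integral_add i3 i4]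
  rw [eq_neg_iff_add_eq_zero, ← integral_add i1 i2] at h
  rw [← h]
  refine integral_congr_ae ?_
  filter_upwards [hdiv, hε1.weakPartial_mul_lipReg hΩ hp j, hB0.1.weakPartial_mul_lipReg hΩ hε j]
    with x h1 h2 h3
  rw [h1, h2, h3]
  ring

/-! ### The discrete spaces -/

theorem ext_add {F : Type} [AddCommGroup F] [TopologicalSpace F] [IsTopologicalAddGroup F]
    (v w : C(closure Ω, F)) : ext (v + w : C(closure Ω, F)) = fun x => ext v x + ext w x := by
  funext x
  by_cases hx : x ∈ closure Ω
  · simp only [ext_apply_of_mem _ hx, ContinuousMap.add_apply]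
  · simp only [ext_apply_of_notMem _ hx, add_zero]

theorem ext_smul {F : Type} [AddCommGroup F] [Module ℝ F] [TopologicalSpace F]
    [ContinuousSMul ℝ F] (s : ℝ) (v : C(closure Ω, F)) :
    ext (s • v : C(closure Ω, F)) = fun x => s • ext v x := by
  funext x
  by_cases hx : x ∈ closure Ω
  · simp only [ext_apply_of_mem _ hx, ContinuousMap.smul_apply]
  · simp only [ext_apply_of_notMem _ hx, smul_zero]

theorem ext_linear_comb {F : Type} [AddCommGroup F] [Module ℝ F] [TopologicalSpace F]
    [IsTopologicalAddGroup F] [ContinuousSMul ℝ F] (s t : ℝ) (v w : C(closure Ω, F)) :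
    ext (s • v + t • w : C(closure Ω, F)) = fun x => s • ext v x + t • ext w x := by
  rw [ext_add, ext_smul, ext_smul]

theorem ext_zero {F : Type} [AddCommGroup F] [TopologicalSpace F] :
    ext (0 : C(closure Ω, F)) = fun _ => 0 := by
  funext x
  by_cases hx : x ∈ closure Ω
  · rw [ext_apply_of_mem _ hx]; rfl
  · exact ext_apply_of_notMem _ hx

/-- A set of functions that is stable under linear combinations, as a subspace. -/
def submoduleOfLinearComb {V : Type*} [AddCommGroup V] [Module ℝ V] (S : Set V) (h0 : (0 : V) ∈ S)
    (h : ∀ v ∈ S, ∀ w ∈ S, ∀ s t : ℝ, s • v + t • w ∈ S) : Submodule ℝ V where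
  carrier := S
  zero_mem' := h0
  add_mem' := fun {v w} hv hw => by simpa using h v hv w hw 1 1
  smul_mem' := fun s v hv => by simpa using h v hv v hv s 0

theorem X0h_linear_comb (hΩ : IsOpen Ω) (T : Triangulation Ω) :
    ∀ v ∈ X0h T, ∀ w ∈ X0h T, ∀ s t : ℝ, s • v + t • w ∈ X0h T := by
  intro v hv w hw s t
  refine ⟨fun κ hκ j => ?_, fun j => ?_⟩
  · rw [ext_linear_comb]
    exact (hv.1 κ hκ j).linear_comb (hw.1 κ hκ j) s t
  · rw [ext_linear_comb]
    exact (hv.2 j).linear_comb hΩ (hw.2 j) s t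

theorem zero_mem_X0h (hΩ : IsOpen Ω) (T : Triangulation Ω) : (0 : C(closure Ω, E d)) ∈ X0h T := by
  refine ⟨fun κ hκ j => ?_, fun j => ?_⟩
  · rw [ext_zero]
    exact isMiniOn_zero
  · rw [ext_zero]
    exact memH10_zero hΩ

theorem M0h_linear_comb (T : Triangulation Ω) :
    ∀ p ∈ M0h T, ∀ q ∈ M0h T, ∀ s t : ℝ, s • p + t • q ∈ M0h T := by
  intro p hp q hq s t
  have := T.isFiniteMeasure
  refine ⟨fun κ hκ => ?_, ?_, ?_⟩
  · rw [ext_linear_comb]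
    exact (hp.1 κ hκ).linear_comb (hq.1 κ hκ) s t
  · rw [ext_linear_comb]
    exact memLp_linear_comb hp.2.1 hq.2.1 s t
  · rw [ext_linear_comb]
    simp only [smul_eq_mul]
    rw [integral_linear_comb (hp.2.1.integrable one_le_two)
      (hq.2.1.integrable one_le_two) (Eventually.of_forall fun x => rfl), hp.2.2, hq.2.2]
    simp

theorem zero_mem_M0h (T : Triangulation Ω) : (0 : C(closure Ω, ℝ)) ∈ M0h T := by
  refine ⟨fun κ hκ => ?_, ?_, ?_⟩
  · rw [ext_zero]
    exact isP1On_zero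
  · rw [ext_zero]
    exact MemLp.zero'
  · rw [ext_zero]
    simp

/-- The space `X_{0h}` as a subspace. -/
def velocitySpace (hΩ : IsOpen Ω) (T : Triangulation Ω) : Submodule ℝ C(closure Ω, E d) :=
  submoduleOfLinearComb (X0h T) (zero_mem_X0h hΩ T) (X0h_linear_comb hΩ T)

/-- The space `M_{0h}` as a subspace. -/
def pressureSpace (T : Triangulation Ω) : Submodule ℝ C(closure Ω, ℝ) :=
  submoduleOfLinearComb (M0h T) (zero_mem_M0h T) (M0h_linear_comb T)

/-! ### Finite dimension of the discrete spaces. -/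

/-- The functions of the local space of the mini-element, restricted to the element. -/
def Elt.miniMap (κ : Elt d) : (ℝ × (Fin d → ℝ) × ℝ) →ₗ[ℝ] (κ.carrier → ℝ) where
  toFun a := fun x => κ.mini a.1 a.2.1 a.2.2 x
  map_add' a b := by
    funext x
    simp only [Elt.mini, Prod.fst_add, Prod.snd_add, Pi.add_apply, add_mul, Finset.sum_add_distrib]
    ring
  map_smul' c a := by
    funext x
    simp only [Elt.mini, Prod.smul_fst, Prod.smul_snd, Pi.smul_apply, smul_eq_mul,
      RingHom.id_apply, mul_add, Finset.mul_sum, mul_assoc]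

theorem IsMiniOn.mem_range {κ : Elt d} {g : E d → ℝ} (h : IsMiniOn κ g) :
    (fun x : κ.carrier => g x) ∈ LinearMap.range κ.miniMap := by
  obtain ⟨a₀, a, c, hg⟩ := h.exists_mini
  exact ⟨(a₀, a, c), funext fun x => (hg x.2).symm⟩

theorem eq_of_forall_carrier {F : Type} [Zero F] [TopologicalSpace F] (T : Triangulation Ω)
    {v w : C(closure Ω, F)} (h : ∀ κ ∈ T.elts, ∀ x ∈ κ.carrier, ext v x = ext w x) : v = w := by
  refine ContinuousMap.ext fun x => ?_
  obtain ⟨κ, hκ, hx⟩ := T.exists_mem x.2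
  have := h κ hκ x hx
  rwa [ext_apply_of_mem v x.2, ext_apply_of_mem w x.2] at this

/-- Restricting each component to each element is an injective linear map into a finite product of
finite-dimensional ranges, so no nodal basis is required. -/
theorem finiteDimensional_velocitySpace (hΩ : IsOpen Ω) (T : Triangulation Ω) :
    FiniteDimensional ℝ (velocitySpace hΩ T) := by
  let R : velocitySpace hΩ T →ₗ[ℝ] ((k : T.elts × Fin d) → LinearMap.range k.1.1.miniMap) :=
    { toFun := fun v k => ⟨fun x => ext v.1 x k.2, (v.2.1 k.1.1 k.1.2 k.2).mem_range⟩
      map_add' := fun v w => by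
        funext k
        refine Subtype.ext (funext fun x => ?_)
        have := congrFun (ext_add v.1 w.1) x
        exact congrArg (fun y : E d => y k.2) this
      map_smul' := fun s v => by
        funext k
        refine Subtype.ext (funext fun x => ?_)
        have := congrFun (ext_smul s v.1) x
        exact congrArg (fun y : E d => y k.2) this }
  refine Module.Finite.of_injective R fun v w hv => ?_
  refine Subtype.ext (eq_of_forall_carrier T fun κ hκ x hx => ?_)
  ext j
  exact congrFun (congrArg Subtype.val (congrFun hv (⟨κ, hκ⟩, j))) ⟨x, hx⟩

theorem finiteDimensional_pressureSpace (T : Triangulation Ω) :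
    FiniteDimensional ℝ (pressureSpace T) := by
  let R : pressureSpace T →ₗ[ℝ] ((κ : T.elts) → LinearMap.range κ.1.miniMap) :=
    { toFun := fun v κ => ⟨fun x => ext v.1 x, (v.2.1 κ.1 κ.2).isMiniOn.mem_range⟩
      map_add' := fun v w => by
        funext κ
        refine Subtype.ext (funext fun x => ?_)
        have := congrFun (ext_add v.1 w.1) x
        exact this
      map_smul' := fun s v => by
        funext κ
        refine Subtype.ext (funext fun x => ?_)
        have := congrFun (ext_smul s v.1) x
        exact this }
  refine Module.Finite.of_injective R fun v w hv => ?_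
  refine Subtype.ext (eq_of_forall_carrier T fun κ hκ x hx => ?_)
  exact congrFun (congrArg Subtype.val (congrFun hv ⟨κ, hκ⟩)) ⟨x, hx⟩

theorem Triangulation.lipReg_velocity (T : Triangulation Ω) (hΩ : IsOpen Ω) {v : C(closure Ω, E d)}
    (hv : v ∈ X0h T) (j : Fin d) : LipReg Ω (fun x => ext v x j) :=
  T.lipReg hΩ ((EuclideanSpace.proj (𝕜 := ℝ) j).continuous.comp_continuousOn (continuousOn_ext v))
    fun κ hκ => hv.1 κ hκ j

theorem Triangulation.memH1Vec_velocity (T : Triangulation Ω) {v : C(closure Ω, E d)}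
    (hv : v ∈ X0h T) : MemH1Vec Ω (ext v) := fun j => (hv.2 j).1

theorem Triangulation.lipReg_Mh (T : Triangulation Ω) (hΩ : IsOpen Ω) {q : C(closure Ω, ℝ)}
    (hq : q ∈ Mh T) : LipReg Ω (ext q) :=
  T.lipReg hΩ (continuousOn_ext q) fun κ hκ => (hq κ hκ).isMiniOn

theorem eq_zero_of_eqOn_zero {F : Type} [AddCommGroup F] [TopologicalSpace F] [T2Space F]
    {v : C(closure Ω, F)} (h : Set.EqOn (ext v) (fun _ => 0) Ω) : v = 0 := by
  have h2 := h.of_subset_closure (continuousOn_ext v) continuousOn_const subset_closure subset_rfl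
  refine ContinuousMap.ext fun x => ?_
  have := h2 x.2
  rwa [ext_apply_of_mem v x.2] at this

/-! ### Uniqueness of the velocity -/

/-- By `cForm_self` the energy is a sum of nonnegative terms. The zeroth-order term with `α (ε x) >
0` must vanish, so `v` is zero almost everywhere in `Ω`, then everywhere by continuity. -/
theorem eq_zero_of_energy_nonpos (hΩ : IsOpen Ω) (T : Triangulation Ω) {Re : ℝ} (hRe : 0 < Re)
    {α β : ℝ → ℝ} {ε : E d → ℝ} (hε : LipReg Ω ε) (hε0 : ∀ x ∈ Ω, 0 ≤ ε x)
    (hα : MemLp (fun x => α (ε x)) ⊤ (volume.restrict Ω)) (hα0 : ∀ x ∈ Ω, 0 < α (ε x))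
    (hβ0 : ∀ x ∈ Ω, 0 < β (ε x)) {u : E d → E d} (hu : MemH1Vec Ω u) {v : C(closure Ω, E d)}
    (hv : v ∈ X0h T) (h : aForm Ω Re α ε (ext v) (ext v) + cForm Ω β ε u (ext v) (ext v) ≤ 0) :
    v = 0 := by
  have hv1 := T.memH1Vec_velocity hv
  rw [cForm_self hΩ hε hu (T.lipReg_velocity hΩ hv) hv.2, aForm] at h
  have h1 : 0 ≤ ∫ x in Ω, ε x * ∑ i : Fin d, ∑ j : Fin d,
      weakPartial Ω i (fun y => ext v y j) x * weakPartial Ω i (fun y => ext v y j) x :=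
    setIntegral_nonneg hΩ.measurableSet fun x hx => mul_nonneg (hε0 x hx)
      (Finset.sum_nonneg fun i _ => Finset.sum_nonneg fun j _ => mul_self_nonneg _)
  have h2 : 0 ≤ ∫ x in Ω, β (ε x) * ‖u x‖ * inner ℝ (ext v x) (ext v x) :=
    setIntegral_nonneg hΩ.measurableSet fun x hx =>
      mul_nonneg (mul_nonneg (hβ0 x hx).le (norm_nonneg _)) real_inner_self_nonneg
  have h3 : 0 ≤ᵐ[volume.restrict Ω] fun x => α (ε x) * inner ℝ (ext v x) (ext v x) :=
    ae_restrict_of_forall_mem hΩ.measurableSet fun x hx =>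
      mul_nonneg (hα0 x hx).le real_inner_self_nonneg
  have h4 : ∫ x in Ω, α (ε x) * inner ℝ (ext v x) (ext v x) = 0 := by
    refine le_antisymm ?_ (integral_nonneg_of_ae h3)
    have := mul_nonneg (one_div_pos.2 hRe).le h1
    linarith
  rw [integral_eq_zero_iff_of_nonneg_ae h3
    (integrable_top_mul hα (integrable_inner (fun j => (hv1 j).1) fun j => (hv1 j).1))] at h4
  have h5 : ext v =ᵐ[volume.restrict Ω] fun _ => 0 := by
    filter_upwards [h4, ae_restrict_mem hΩ.measurableSet] with x hx hxΩ
    exact inner_self_eq_zero.1 ((mul_eq_zero.1 hx).resolve_left (hα0 x hxΩ).ne')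
  exact eq_zero_of_eqOn_zero (Measure.eqOn_open_of_ae_eq h5 hΩ
    ((continuousOn_ext v).mono subset_closure) continuousOn_const)

/-! ### Uniqueness of the pressure -/

/-- The velocity field `b_κ e_j`. -/
def Elt.bubVec (Ω : Set (E d)) (κ : Elt d) (j : Fin d) : C(closure Ω, E d) where
  toFun x := EuclideanSpace.single j (κ.bub x)
  continuous_toFun := by
    have : Continuous fun t : ℝ => (EuclideanSpace.single j t : E d) := by
      have h : (fun t : ℝ => (EuclideanSpace.single j t : E d))
          = fun t => t • EuclideanSpace.single j 1 := by
        funext t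
        ext k
        simp [PiLp.single_apply]
      rw [h]
      fun_prop
    exact this.comp (κ.continuous_bub.comp continuous_subtype_val)

theorem Triangulation.ext_bubVec (T : Triangulation Ω) {κ : Elt d} (hκ : κ ∈ T.elts) (j : Fin d) :
    ext (κ.bubVec Ω j) = fun x => EuclideanSpace.single j (κ.bub x) := by
  funext x
  by_cases hx : x ∈ closure Ω
  · rw [ext_apply_of_mem _ hx]
    rfl
  · rw [ext_apply_of_notMem _ hx, κ.bub_of_notMem fun h => hx (T.carrier_subset hκ h)]
    ext k
    simp [PiLp.single_apply]

theorem Triangulation.bubVec_mem (T : Triangulation Ω) (hΩ : IsOpen Ω)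
    (hΩr : interior (closure Ω) = Ω) {κ : Elt d} (hκ : κ ∈ T.elts) (j : Fin d) :
    κ.bubVec Ω j ∈ X0h T := by
  refine ⟨fun κ' hκ' k => ?_, fun k => ?_⟩ <;> rw [T.ext_bubVec hκ] <;>
    rcases eq_or_ne k j with rfl | hkj
  · simpa using T.isMiniOn_bub hκ hκ'
  · simpa [PiLp.single_apply, hkj] using isMiniOn_zero
  · simpa using T.memH10_bub hΩ hΩr hκ
  · simpa [PiLp.single_apply, hkj] using memH10_zero hΩ

/-- A zero integral would make the continuous nonnegative integrand vanish on all of `Ω`, whereas it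
is positive inside `κ`. -/
theorem Elt.integral_mul_bub_pos (hΩ : IsOpen Ω) {κ : Elt d}
    (hκ : interior κ.carrier ⊆ Ω) {ε : E d → ℝ} (hε : ContinuousOn ε Ω) (hε0 : ∀ x ∈ Ω, 0 < ε x)
    (hint : Integrable (fun x => ε x * κ.bub x) (volume.restrict Ω)) :
    0 < ∫ x in Ω, ε x * κ.bub x := by
  have h0 : 0 ≤ᵐ[volume.restrict Ω] fun x => ε x * κ.bub x :=
    ae_restrict_of_forall_mem hΩ.measurableSet fun x hx =>
      mul_nonneg (hε0 x hx).le (κ.bub_nonneg x)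
  refine lt_of_le_of_ne (integral_nonneg_of_ae h0) fun h => ?_
  rw [eq_comm, integral_eq_zero_iff_of_nonneg_ae h0 hint] at h
  have h1 := Measure.eqOn_open_of_ae_eq h hΩ (hε.mul κ.continuous_bub.continuousOn)
    continuousOn_const
  obtain ⟨x, hx⟩ := κ.nonempty_interior
  exact (mul_pos (hε0 x (hκ hx)) (κ.bub_pos hx)).ne' (h1 (hκ hx))

/-- On the interior of `κ`, off which the bubble is zero, ∂ⱼp is the constant slope `a j`. The form
is thus minus `a j` times a positive integral, and every slope vanishes. -/
theorem IsP1On.eq_const_of_bForm_bubVec (hΩ : IsOpen Ω) (hΩr : interior (closure Ω) = Ω)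
    (T : Triangulation Ω) {ε : E d → ℝ} (hε : LipReg Ω ε) (hε0 : ∀ x ∈ Ω, 0 < ε x)
    {p : E d → ℝ} (hp : LipReg Ω p) {κ : Elt d} (hκ : κ ∈ T.elts) (hpκ : IsP1On κ.carrier p)
    (h : ∀ j, bForm Ω ε (ext (κ.bubVec Ω j)) p = 0) : ∃ c, ∀ x ∈ κ.carrier, p x = c := by
  have := T.isFiniteMeasure
  obtain ⟨a₀, a, ha⟩ := hpκ.exists_mini
  have hB0 := T.memH10_bub hΩ hΩr hκ
  have hpos := κ.integral_mul_bub_pos hΩ (T.interior_subset hΩr hκ) (hε.continuousOn hΩ) hε0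
    (integrable_top_mul (hε.memLp_top hΩ) (hB0.1.1.integrable one_le_two))
  have haj : ∀ j, a j = 0 := by
    intro j
    have hj := h j
    rw [T.ext_bubVec hκ, bForm_single hΩ hε hB0 hp j, neg_eq_zero] at hj
    have e : ∫ x in Ω, ε x * weakPartial Ω j p x * κ.bub x
        = ∫ x in Ω, a j * (ε x * κ.bub x) := by
      refine integral_congr_ae ?_
      filter_upwards [hp.weakPartial_ae_eq hΩ j] with x hx
      by_cases hxκ : x ∈ interior κ.carrier
      · have : p =ᶠ[𝓝 x] κ.mini a₀ a 0 :=
          ha.eventuallyEq_of_mem (mem_interior_iff_mem_nhds.1 hxκ)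
        rw [hx, classicalPartial, this.fderiv_eq]
        have h3 := κ.classicalPartial_mini_zero a₀ a j x
        rw [classicalPartial] at h3
        rw [h3]
        ring
      · rw [κ.bub_eq_zero hxκ]
        ring
    rw [e, integral_const_mul] at hj
    exact (mul_eq_zero.1 hj).resolve_right hpos.ne'
  exact ⟨a₀, fun x hx => by simp [ha hx, Elt.mini, haj]⟩

/-- The image is a preconnected subset of the line, so two distinct values would bring a whole
infinite interval. Applied to elementwise constant pressures, this replaces a chain of neighbouring
elements. -/
theorem exists_eq_const_of_finite_range {X : Type*} [TopologicalSpace X] {s : Set X}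
    (hs : IsPreconnected s) {p : X → ℝ} (hp : ContinuousOn p s) (hf : (p '' s).Finite) :
    ∃ c, ∀ x ∈ s, p x = c := by
  have hsub : (p '' s).Subsingleton := by
    have hc := hs.image p hp
    intro a ha b hb
    by_contra hab
    wlog hlt : a < b generalizing a b
    · exact this hb ha (Ne.symm hab) (lt_of_le_of_ne (not_lt.1 hlt) (Ne.symm hab))
    exact Set.Icc_infinite hlt (hf.subset (hc.Icc_subset ha hb))
  rcases s.eq_empty_or_nonempty with rfl | ⟨y, hy⟩
  · exact ⟨0, by simp⟩
  · exact ⟨p y, fun x hx => hsub ⟨x, hx, rfl⟩ ⟨y, hy, rfl⟩⟩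

theorem eq_zero_of_bForm_eq_zero (hΩ : IsOpen Ω) (hΩc : IsConnected Ω)
    (hΩr : interior (closure Ω) = Ω) (T : Triangulation Ω) {ε : E d → ℝ} (hε : LipReg Ω ε)
    (hε0 : ∀ x ∈ Ω, 0 < ε x) {p : C(closure Ω, ℝ)} (hp : p ∈ M0h T)
    (h : ∀ v ∈ X0h T, bForm Ω ε (ext v) (ext p) = 0) : p = 0 := by
  have := T.isFiniteMeasure
  have hconst : ∀ κ ∈ T.elts, ∃ c, ∀ x ∈ κ.carrier, ext p x = c := fun κ hκ =>
    (hp.1 κ hκ).eq_const_of_bForm_bubVec hΩ hΩr T hε hε0 (T.lipReg_Mh hΩ hp.1) hκ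
      fun j => h _ (T.bubVec_mem hΩ hΩr hκ j)
  choose! c hc using hconst
  have hfin : (ext p '' Ω).Finite := by
    refine (T.elts.finite_toSet.image c).subset ?_
    rintro _ ⟨x, hx, rfl⟩
    obtain ⟨κ, hκ, hxκ⟩ := T.exists_mem (subset_closure hx)
    exact ⟨κ, hκ, (hc κ hκ x hxκ).symm⟩
  obtain ⟨b, hb⟩ := exists_eq_const_of_finite_range hΩc.isPreconnected
    ((continuousOn_ext p).mono subset_closure) hfin
  have hmean := hp.2.2
  rw [setIntegral_congr_fun hΩ.measurableSet hb, setIntegral_const, smul_eq_mul] at hmean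
  have hvol : volume.real Ω ≠ 0 := by
    rw [measureReal_def, ENNReal.toReal_ne_zero]
    exact ⟨(hΩ.measure_pos volume hΩc.nonempty).ne',
      ((measure_mono subset_closure).trans_lt T.isCompact_closure.measure_lt_top).ne⟩
  have hb0 : b = 0 := (mul_eq_zero.1 hmean).resolve_left hvol
  exact eq_zero_of_eqOn_zero fun x hx => (hb x hx).trans hb0

/-! ### The linear system -/

/-- Unique solvability of a finite-dimensional saddle point problem. -/
theorem existsUnique_saddle {X M : Type*} [AddCommGroup X] [Module ℝ X] [FiniteDimensional ℝ X]
    [AddCommGroup M] [Module ℝ M] [FiniteDimensional ℝ M] (A : X →ₗ[ℝ] X →ₗ[ℝ] ℝ)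
    (B : X →ₗ[ℝ] M →ₗ[ℝ] ℝ) (hA : ∀ w, A w w = 0 → w = 0)
    (hB : ∀ p, (∀ v, B v p = 0) → p = 0) (F : X →ₗ[ℝ] ℝ) :
    ∃! wp : X × M, (∀ v, A wp.1 v - B v wp.2 = F v) ∧ ∀ q, B wp.1 q = 0 := by
  let Φ : (X × M) →ₗ[ℝ] (Module.Dual ℝ X × Module.Dual ℝ M) :=
    (A.comp (LinearMap.fst ℝ X M) - B.flip.comp (LinearMap.snd ℝ X M)).prod
      (B.comp (LinearMap.fst ℝ X M))
  have hΦ : ∀ wp v q, (Φ wp).1 v = A wp.1 v - B v wp.2 ∧ (Φ wp).2 q = B wp.1 q :=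
    fun wp v q => ⟨rfl, rfl⟩
  have hinj : Function.Injective Φ := by
    refine (injective_iff_map_eq_zero Φ).2 fun wp hwp => ?_
    have h1 : ∀ v, A wp.1 v - B v wp.2 = 0 := fun v => by
      rw [← (hΦ wp v 0).1, hwp]
      rfl
    have h2 : ∀ q, B wp.1 q = 0 := fun q => by
      rw [← (hΦ wp 0 q).2, hwp]
      rfl
    -- Test the first equation with the velocity itself; the second equation removes the pressure
    -- term.
    have hw : wp.1 = 0 := hA _ (by have := h1 wp.1; rwa [h2, sub_zero] at this)
    have hp : wp.2 = 0 := hB _ fun v => by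
      have := h1 v
      rw [hw] at this
      simpa using this
    exact Prod.ext hw hp
  -- A finite-dimensional space and its dual have equal dimension, so the system is square.
  have hsurj : Function.Surjective Φ :=
    (LinearMap.injective_iff_surjective_of_finrank_eq_finrank (by
      rw [Module.finrank_prod, Module.finrank_prod, Subspace.dual_finrank_eq,
        Subspace.dual_finrank_eq])).1 hinj
  have hiff : ∀ wp, ((∀ v, A wp.1 v - B v wp.2 = F v) ∧ ∀ q, B wp.1 q = 0) ↔ Φ wp = (F, 0) := by
    intro wp
    constructor
    · rintro ⟨h1, h2⟩
      exact Prod.ext (LinearMap.ext h1) (LinearMap.ext h2)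
    · intro h
      exact ⟨fun v => by rw [← (hΦ wp v 0).1, h], fun q => by rw [← (hΦ wp 0 q).2, h]; rfl⟩
  obtain ⟨wp, hwp⟩ := hsurj (F, 0)
  exact ⟨wp, (hiff wp).2 hwp, fun wp' h' => hinj (((hiff wp').1 h').trans hwp.symm)⟩

/-- A function of two vectors that respects linear combinations, as a bilinear map. -/
def bilinOfLinearComb {X M : Type*} [AddCommGroup X] [Module ℝ X] [AddCommGroup M] [Module ℝ M]
    (f : X → M → ℝ) (h₁ : ∀ s t v w q, f (s • v + t • w) q = s * f v q + t * f w q)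
    (h₂ : ∀ s t v p q, f v (s • p + t • q) = s * f v p + t * f v q) : X →ₗ[ℝ] M →ₗ[ℝ] ℝ :=
  LinearMap.mk₂ ℝ f (fun v w q => by simpa using h₁ 1 1 v w q)
    (fun s v q => by simpa using h₁ s 0 v v q) (fun v p q => by simpa using h₂ 1 1 v p q)
    (fun s v q => by simpa using h₂ s 0 v q q)

/-- A function that respects linear combinations, as a linear form. -/
def formOfLinearComb {X : Type*} [AddCommGroup X] [Module ℝ X] (f : X → ℝ)
    (h : ∀ s t v w, f (s • v + t • w) = s * f v + t * f w) : X →ₗ[ℝ] ℝ where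
  toFun := f
  map_add' v w := by simpa using h 1 1 v w
  map_smul' s v := by simpa using h s 0 v v

end DBF

end

/-! ### The theorem, as an instance of the saddle point problem. -/

theorem theorem3p2 {d : ℕ} (hd : d = 2 ∨ d = 3)
    (Ω : Set (DBF.E d)) (hΩo : IsOpen Ω) (hΩc : IsConnected Ω)
    (hΩr : interior (closure Ω) = Ω)
    (T : DBF.Triangulation Ω)
    (Re : ℝ) (hRe : 0 < Re)
    (ε₀ : ℝ) (hε₀ : 0 < ε₀)
    (α β : ℝ → ℝ) (hα : DBF.AdmissibleCoeff ε₀ α) (hβ : DBF.AdmissibleCoeff ε₀ β)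
    (εh : C(closure Ω, ℝ)) (hεh : εh ∈ DBF.Mh T)
    (hεh_bd : ∀ x : closure Ω, (x : DBF.E d) ∈ Ω → ε₀ ≤ εh x ∧ εh x ≤ 1)
    (f : DBF.E d → DBF.E d)
    (hf : MeasureTheory.MemLp f 2 (MeasureTheory.volume.restrict Ω))
    (G : DBF.E d → DBF.E d) (hG : DBF.MemH1Vec Ω G)
    (w : C(closure Ω, DBF.E d)) (hw : w ∈ DBF.X0h T) :
    ∃! wp : C(closure Ω, DBF.E d) × C(closure Ω, ℝ),
      wp.1 ∈ DBF.X0h T ∧ wp.2 ∈ DBF.M0h T ∧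
        DBF.IsNextIterate T Re α β εh f G w wp.1 wp.2 := by
  have hεreg := T.lipReg_Mh hΩo hεh
  have hεI : ∀ x ∈ Ω, DBF.ext εh x ∈ Set.Icc ε₀ 1 := fun x hx => by
    rw [DBF.ext_apply_of_mem _ (subset_closure hx)]
    exact hεh_bd ⟨x, subset_closure hx⟩ hx
  have hε0 : ∀ x ∈ Ω, 0 < DBF.ext εh x := fun x hx => hε₀.trans_le (hεI x hx).1
  have hαm := hα.memLp_top hΩo hεreg hεI
  have hβm := hβ.memLp_top hΩo hεreg hεI
  have hu : DBF.MemH1Vec Ω (fun x => DBF.ext w x + G x) := by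
    simpa using (T.memH1Vec_velocity hw).linear_comb hΩo hG 1 1
  have := DBF.finiteDimensional_velocitySpace hΩo T
  have := DBF.finiteDimensional_pressureSpace T
  have hH1 : ∀ v : DBF.velocitySpace hΩo T, DBF.MemH1Vec Ω (DBF.ext v.1) :=
    fun v => T.memH1Vec_velocity v.2
  have hLip : ∀ (v : DBF.velocitySpace hΩo T) j, DBF.LipReg Ω fun x => DBF.ext v.1 x j :=
    fun v => T.lipReg_velocity hΩo v.2
  have hX : ∀ (s t : ℝ) (v v' : DBF.velocitySpace hΩo T), DBF.ext (s • v + t • v').1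
      = fun x => s • DBF.ext v.1 x + t • DBF.ext v'.1 x :=
    fun s t v v' => DBF.ext_linear_comb s t v.1 v'.1
  have hM : ∀ (s t : ℝ) (p q : DBF.pressureSpace T), DBF.ext (s • p + t • q).1
      = fun x => s * DBF.ext p.1 x + t * DBF.ext q.1 x :=
    fun s t p q => DBF.ext_linear_comb s t p.1 q.1
  -- With the iterate frozen in the first slot of the trilinear form, the left-hand side is bilinear
  -- in the new velocity and the test field.
  let A := DBF.bilinOfLinearComb (fun v v' : DBF.velocitySpace hΩo T =>
      DBF.aForm Ω Re α (DBF.ext εh) (DBF.ext v.1) (DBF.ext v'.1)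
        + DBF.cForm Ω β (DBF.ext εh) (fun x => DBF.ext w x + G x) (DBF.ext v.1) (DBF.ext v'.1))
    (fun s t v v' q => by
      rw [hX, DBF.aForm_linear_left hΩo Re hεreg hαm (hH1 q) (hH1 v) (hH1 v'),
        DBF.cForm_linear_middle hΩo hεreg hβm hu (hH1 v) (hH1 v') (hLip q)]
      ring)
    (fun s t q v v' => by
      rw [hX, DBF.aForm_linear_right hΩo Re hεreg hαm (hH1 q) (hH1 v) (hH1 v'),
        DBF.cForm_linear_right hΩo hεreg hβm hu (hH1 q) (hLip v) (hLip v')]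
      ring)
  let B := DBF.bilinOfLinearComb (fun (v : DBF.velocitySpace hΩo T) (q : DBF.pressureSpace T) =>
      DBF.bForm Ω (DBF.ext εh) (DBF.ext v.1) (DBF.ext q.1))
    (fun s t v v' q => by
      rw [hX, DBF.bForm_linear_left hΩo hεreg q.2.2.1 (hH1 v) (hH1 v')])
    (fun s t v p q => by
      rw [hM, DBF.bForm_linear_right hΩo hεreg p.2.2.1 q.2.2.1 (hH1 v)])
  let F := DBF.formOfLinearComb (fun v : DBF.velocitySpace hΩo T =>
      DBF.lForm Ω (DBF.ext εh) f (DBF.ext v.1)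
        - DBF.aForm Ω Re α (DBF.ext εh) G (DBF.ext v.1)
        - DBF.cForm Ω β (DBF.ext εh) (fun x => DBF.ext w x + G x) G (DBF.ext v.1))
    (fun s t v v' => by
      rw [hX, DBF.lForm_linear hΩo hεreg hf (hH1 v) (hH1 v'),
        DBF.aForm_linear_right hΩo Re hεreg hαm hG (hH1 v) (hH1 v'),
        DBF.cForm_linear_right hΩo hεreg hβm hu hG (hLip v) (hLip v')]
      ring)
  obtain ⟨⟨w', p'⟩, ⟨h1, h2⟩, huniq⟩ := DBF.existsUnique_saddle (X := DBF.velocitySpace hΩo T)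
    (M := DBF.pressureSpace T) A B
    (fun v hv => Subtype.ext (DBF.eq_zero_of_energy_nonpos hΩo T hRe hεreg
      (fun x hx => (hε0 x hx).le) hαm (fun x hx => hα.pos _ (hεI x hx))
      (fun x hx => hβ.pos _ (hεI x hx)) hu v.2 (le_of_eq hv)))
    (fun p hp => Subtype.ext (DBF.eq_zero_of_bForm_eq_zero hΩo hΩc hΩr T hεreg hε0 p.2
      fun v hv => hp ⟨v, hv⟩)) F
  refine ⟨(w'.1, p'.1), ⟨w'.2, p'.2, fun v hv => h1 ⟨v, hv⟩, fun q hq => h2 ⟨q, hq⟩⟩, ?_⟩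
  rintro ⟨w₂, p₂⟩ ⟨hw₂, hp₂, h3, h4⟩
  have := huniq (⟨w₂, hw₂⟩, ⟨p₂, hp₂⟩) ⟨fun v => h3 v.1 v.2, fun q => h4 q.1 q.2⟩
  rw [Prod.ext_iff] at this
  exact Prod.ext (congrArg Subtype.val this.1) (congrArg Subtype.val this.2)
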